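/- Lemma (Sublinear Crossing Lemma for cycle packing). Let $B$ be a finite simple planar bipartite graph with bipartition $V(B)=W\uplus S$, and let $G$ be its half-square on $W$: $V(G)=W$, and two vertices of $W$ are adjacent in $G$ if and only if they are at distance $2$ in $B$ (so $G$ is a map graph and $B$ is a planar bipartite graph corresponding to $G$). Let $k\ge 0$ be an integer and let $\mathcal D=(T,\beta_{\mathcal D})$ be a nice tree decomposition of $B$ of width less than $15\sqrt k$, where $T$ is a finite rooted tree. Here nice means that the root has an empty bag and every node is a leaf with an empty bag, or has exactly one child and its bag arises from the bag of that child by removing one vertex or by adding one vertex, or has exactly two children and the same bag as both of them. The width is the largest size of a bag minus one. For a family of bags $\beta$ on $T$ let $\gamma(t)$ denote the union of the bags of $t$ and of all its descendants. Let $\mathcal D'=(T,\beta_{\mathcal D'})$ be the $(15\sqrt k,\mathcal D)$-decomposition of $G$ derived from $\mathcal D$, that is, $$\beta_{\mathcal D'}(t)=(\beta_{\mathcal D}(t)\cap W)\ \cup\bigcup_{s\in\beta_{\mathcal D}(t)\cap S}\bigl(N_B(s)\cap\gamma_{\mathcal D}(t)\bigr)\qquad (t\in V(T)).$$ If $G$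 has $k$ pairwise vertex-disjoint cycles, then there is a set $\mathcal C$ of $k$ pairwise vertex-disjoint cycles of $G$ such that every cycle in $\mathcal C$ is an induced cycle of $G$ and, for every node $t\in V(T)$, the number of edges of the cycles in $\mathcal C$ with one endpoint in $\beta_{\mathcal D'}(t)$ and the other in $V(G)\setminus\gamma_{\mathcal D'}(t)$ is at most $360\sqrt k$. -/

import Mathlib

namespace MapGraph

/-! ### Planar graphs -/

/-- A drawing of a graph in the Euclidean plane without crossings: distinct vertices are distinct
points, every edge is a simple arc joining its two endpoints, and an arc meets the vertices and the
other arcs only in its extreme points. -/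
structure PlaneDrawing {V : Type*} (G : SimpleGraph V) where
  /-- the point representing a vertex -/
  point : V → EuclideanSpace ℝ (Fin 2)
  /-- the arc representing an edge -/
  arc : G.edgeSet → unitInterval → EuclideanSpace ℝ (Fin 2)
  point_injective : Function.Injective point
  arc_continuous : ∀ e, Continuous (arc e)
  arc_injective : ∀ e, Function.Injective (arc e)
  arc_ends : ∀ e, s(arc e 0, arc e 1) = Sym2.map point e.1
  arc_avoids_points : ∀ e x v, arc e x = point v → x = 0 ∨ x = 1
  arc_avoids_arcs : ∀ e f, e ≠ f → ∀ x y, arc e x = arc f y → x = 0 ∨ x = 1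

/-- A graph is planar if it can be drawn in the Euclidean plane without crossings. -/
def IsPlanar {V : Type*} (G : SimpleGraph V) : Prop :=
  Nonempty (PlaneDrawing G)

/-! ### Half-squares -/

/-- The half-square, on the side `W`, of a bipartite graph with sides `W` and `S`: two vertices of
`W` are adjacent if they are at distance two in the bipartite graph. -/
def halfSquare {W S : Type*} (B : SimpleGraph (W ⊕ S)) : SimpleGraph W where
  Adj u v := B.dist (Sum.inl u) (Sum.inl v) = 2
  symm := ⟨fun u v h => by rw [SimpleGraph.dist_comm]; exact h⟩
  loopless := ⟨fun u h => by simp [SimpleGraph.dist_self] at h⟩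

/-! ### Tree decompositions

The tree is a `RootedTree`, that is, an order whose least element is the root; `t ≤ t'` means that
`t'` is `t` or a descendant of `t`, and `t ⋖ t'` means that `t'` is a child of `t`. -/

/-- The family of bags `bag`, indexed by the nodes of the rooted tree `T`, is a tree decomposition
of `G`. The tree, as a graph, is the Hasse diagram of `T`. -/
structure IsTreeDecomposition {V : Type*} (G : SimpleGraph V) (T : RootedTree)
    (bag : T → Set V) : Prop where
  vertex_mem : ∀ v, ∃ t, v ∈ bag t
  edge_mem : ∀ u v, G.Adj u v → ∃ t, u ∈ bag t ∧ v ∈ bag t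
  connected : ∀ v, ((SimpleGraph.hasse T).induce {t | v ∈ bag t}).Connected

/-- The union of the bags of `t` and of its descendants. -/
def cone {V : Type*} {T : RootedTree} (bag : T → Set V) (t : T) : Set V :=
  {v | ∃ t', t ≤ t' ∧ v ∈ bag t'}

/-- The width (used for bags that are finite sets): the largest size of a bag, minus one. -/
noncomputable def width {V : Type*} {T : RootedTree} [Fintype T] (bag : T → Set V) : ℤ :=
  ((Finset.univ.sup fun t => (bag t).ncard : ℕ) : ℤ) - 1

/-- The set of children of a node. -/
def children {T : RootedTree} (t : T) : Set T := {c | t ⋖ c}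

/-- `t` is a leaf with an empty bag. -/
def IsLeafNode {V : Type*} {T : RootedTree} (bag : T → Set V) (t : T) : Prop :=
  children t = ∅ ∧ bag t = ∅

/-- `t` has exactly one child, from whose bag one vertex is removed. -/
def IsForgetNode {V : Type*} {T : RootedTree} (bag : T → Set V) (t : T) : Prop :=
  ∃ c, children t = {c} ∧ ∃ v ∈ bag c, bag t = bag c \ {v}

/-- `t` has exactly one child, to whose bag one new vertex is added. -/
def IsIntroduceNode {V : Type*} {T : RootedTree} (bag : T → Set V) (t : T) : Prop :=
  ∃ c, children t = {c} ∧ ∃ v ∈ bag t, bag t \ {v} = bag c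

/-- `t` has exactly two children, both with the same bag as `t`. -/
def IsJoinNode {V : Type*} {T : RootedTree} (bag : T → Set V) (t : T) : Prop :=
  ∃ c d, c ≠ d ∧ children t = {c, d} ∧ bag t = bag c ∧ bag t = bag d

/-- A nice tree decomposition of `G`. -/
structure IsNiceTreeDecomposition {V : Type*} (G : SimpleGraph V) (T : RootedTree)
    (bag : T → Set V) : Prop extends IsTreeDecomposition G T bag where
  root_empty : bag ⊥ = ∅
  node_type : ∀ t, IsLeafNode bag t ∨ IsForgetNode bag t ∨ IsIntroduceNode bag t ∨ IsJoinNode bag t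

/-- The bags derived from a tree decomposition of the bipartite graph `B`: every special vertex
`s : S` in the bag of `t` is replaced by those of its neighbours that occur in the bag of `t` or of
a descendant of `t`. -/
def derivedBag {W S : Type*} (B : SimpleGraph (W ⊕ S)) {T : RootedTree}
    (bag : T → Set (W ⊕ S)) (t : T) : Set W :=
  {v | Sum.inl v ∈ bag t} ∪
    ⋃ s ∈ {s : S | Sum.inr s ∈ bag t},
      {v | B.Adj (Sum.inr s) (Sum.inl v) ∧ Sum.inl v ∈ cone bag t}

/-! ### Cycle packings -/

/-- `k` pairwise vertex-disjoint cycles in `G`. -/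
structure CyclePacking {V : Type*} (G : SimpleGraph V) (k : ℕ) where
  /-- a vertex of the `i`-th cycle, at which it is read off -/
  base : Fin k → V
  /-- the `i`-th cycle -/
  cycle : ∀ i, G.Walk (base i) (base i)
  isCycle : ∀ i, (cycle i).IsCycle
  disjoint : ∀ i j, i ≠ j → ∀ v, v ∈ (cycle i).support → v ∉ (cycle j).support

/-- Every cycle of the packing is an induced cycle of `G`, that is, it has no chords. -/
def CyclePacking.IsInduced {V : Type*} {G : SimpleGraph V} {k : ℕ} (C : CyclePacking G k) : Prop :=
  ∀ i, ∀ u ∈ (C.cycle i).support, ∀ v ∈ (C.cycle i).support,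
    G.Adj u v → s(u, v) ∈ (C.cycle i).edges

/-- The edges of the cycles of the packing with one endpoint in `X` and the other in `Y`. -/
def CyclePacking.edgesBetween {V : Type*} {G : SimpleGraph V} {k : ℕ} (C : CyclePacking G k)
    (X Y : Set V) : Set (Sym2 V) :=
  {e | (∃ i, e ∈ (C.cycle i).edges) ∧ ∃ u ∈ X, ∃ v ∈ Y, e = s(u, v)}

end MapGraph

section LogChange

open scoped unitInterval

/-! ### Logarithmic change along arcs -/

/-! Take `k` disjoint cycles of least total `weight`: a triangle inside the neighbourhood of one
special vertex costs 0, any other cycle its length. Minimality makes all cycles induced. Exchanging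
cycles for triangles of weight 0 shows that the remaining cycles lift to closed curves of `B`
without repeated vertices, any two of which share at most one vertex (`exists_closedCurves`). The
triangles at a special vertex `s` are regrouped: any three neighbours of `s` form a triangle, and
`exists_triples` picks the triples so that each set of the laminar family `cone bag t \ bag t`
splits at most two of them.

Fix `t` and let `X` be its bag. At most 2|X| counted edges have an end in `X`. Every other one runs
from the cone minus the bag to the outside of the cone, and every special vertex adjacent to both
its ends lies in `X`. Split triangles contribute at most 2·3 edges per special vertex of `X`. A
closed curve that crosses the border of the cone at `s` must cross it again at another vertex of
`X`, so `ncard_visits_le` allows at most 6|X| such edges. The total is 14|X|, with |X| < 15√k + 1.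

For `ncard_visits_le`, consecutive visits to `X` along the curves are joined to form a graph on `X`.
Its edges may meet inside, but independent ones cross algebraically zero times, because closed
curves do. Crossings are expressed through changes of logarithms (`IsLogChange`). This property
survives contraction and fails for the complete graph on five vertices, so Mader's argument bounds
the number of edges by 3n - 6. -/

instance unitInterval.instContractibleSpace : ContractibleSpace I :=
  (convex_Icc (0 : ℝ) 1).contractibleSpace ⟨0, by simp⟩

instance unitInterval.instLocallyPathConnectedSpace : LocallyPathConnectedSpace I :=
  (isQuotientMap_projIcc (h := zero_le_one' ℝ)).locallyPathConnectedSpace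

/-- The change of a continuous logarithm along a path in the punctured plane. -/
noncomputable def logChange (γ : I → ℂ) : ℂ :=
  open Classical in
  if h : ∃ l : C(I, ℂ), ∀ x, Complex.exp (l x) = γ x then h.choose 1 - h.choose 0 else 0

/-- The exponential covers the punctured plane, so maps from such a domain lift. It is needed for
the interval and for the square. -/
theorem exists_continuous_log {A : Type*} [TopologicalSpace A] [SimplyConnectedSpace A]
    [LocallyPathConnectedSpace A] (f : C(A, ℂ)) (hf : ∀ a, f a ≠ 0) :
    ∃ l : C(A, ℂ), ∀ a, Complex.exp (l a) = f a := by
  obtain ⟨a₀⟩ : Nonempty A := inferInstance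
  obtain ⟨l, ⟨-, hl⟩, -⟩ := Complex.isCoveringMapOn_exp.existsUnique_continuousMap_lifts f
    (Complex.exp_log (hf a₀)) hf
  exact ⟨l, fun a => congrFun hl a⟩

/-- Lifts with the same initial value agree, so the increment does not depend on the logarithm. The
factor `c` serves to treat `p - q` and `q - p` with one logarithm, by `c = -1`. -/
theorem logChange_eq {γ : I → ℂ} (l : C(I, ℂ)) (c : ℂ) (hc : c ≠ 0)
    (hl : ∀ x, Complex.exp (l x) = c * γ x) : logChange γ = l 1 - l 0 := by
  have h : ∃ l : C(I, ℂ), ∀ x, Complex.exp (l x) = γ x := by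
    refine ⟨l - ContinuousMap.const _ (Complex.log c), fun x => ?_⟩
    simp [Complex.exp_sub, hl, Complex.exp_log hc, hc]
  rw [logChange, dif_pos h]
  have hm := h.choose_spec
  set m := h.choose
  have hexp : Complex.exp (l 0) = c * Complex.exp (m 0) := by rw [hl, hm]
  have hu := Complex.isCoveringMapOn_exp.existsUnique_continuousMap_lifts
    (⟨fun x => Complex.exp (l x), by fun_prop⟩ : C(I, ℂ)) (a₀ := 0) (e₀ := l 0) rfl
    (fun x => Complex.exp_ne_zero _)
  have := hu.unique (y₁ := l) (y₂ := m + ContinuousMap.const _ (l 0 - m 0)) ⟨rfl, rfl⟩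
    ⟨by simp, by
      funext x
      simp only [Function.comp, ContinuousMap.add_apply, ContinuousMap.const_apply,
        ContinuousMap.coe_mk]
      rw [Complex.exp_add, Complex.exp_sub, hexp, hm, hl]
      field_simp [Complex.exp_ne_zero]⟩
  have h1 := congrArg (fun f : C(I, ℂ) => f 1) this
  simp only [ContinuousMap.add_apply, ContinuousMap.const_apply] at h1
  rw [h1]; ring

theorem exp_logChange (γ : C(I, ℂ)) (h : ∀ x, γ x ≠ 0) :
    Complex.exp (logChange γ) * γ 0 = γ 1 := by
  obtain ⟨l, hl⟩ := exists_continuous_log γ h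
  rw [logChange_eq l 1 one_ne_zero (by simpa using hl), ← hl, ← hl, ← Complex.exp_add]
  congr 1; ring

/-- The difference `p x - q y` has a continuous logarithm on the whole square; the four terms are
its increments along the sides, and these cancel around the boundary. -/
theorem logChange_square (p q : C(I, ℂ)) (h : ∀ x y, p x ≠ q y) :
    logChange (fun x => p x - q 0) - logChange (fun x => p x - q 1)
      + logChange (fun y => q y - p 1) - logChange (fun y => q y - p 0) = 0 := by
  obtain ⟨l, hl⟩ := exists_continuous_log
    (⟨fun z : I × I => p z.1 - q z.2, by fun_prop⟩ : C(I × I, ℂ))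
    (fun z => sub_ne_zero.2 (h _ _))
  simp only [ContinuousMap.coe_mk] at hl
  have h1 : ∀ y, logChange (fun x => p x - q y) = l (1, y) - l (0, y) := fun y =>
    logChange_eq (⟨fun x => l (x, y), by fun_prop⟩ : C(I, ℂ)) 1 one_ne_zero
      (fun x => by simp [hl])
  have h2 : ∀ x, logChange (fun y => q y - p x) = l (x, 1) - l (x, 0) := fun x =>
    logChange_eq (⟨fun y => l (x, y), by fun_prop⟩ : C(I, ℂ)) (-1) (by simp)
      (fun x => by simp [hl])
  rw [h1, h1, h2, h2]; ring

/-- `θ v a b` has the properties of the change of `log (z - pt v)` as `z` runs along the edge from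
`a` to `b` of a drawing of `H` in which any two edges without a common end cross algebraically zero
times. -/
structure IsLogChange {V : Type*} (H : SimpleGraph V) (pt : V → ℂ) (A : Set V)
    (θ : V → V → V → ℂ) : Prop where
  exp_mul : ∀ a b, H.Adj a b → ∀ v ∈ A, v ≠ a → v ≠ b →
    Complex.exp (θ v a b) * (pt a - pt v) = pt b - pt v
  crossing : ∀ a b c d, H.Adj a b → H.Adj c d → a ≠ c → a ≠ d → b ≠ c → b ≠ d →
    θ c a b - θ d a b + θ b c d - θ a c d = 0

theorem MapGraph.PlaneDrawing.exists_isLogChange {V : Type*} {G : SimpleGraph V}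
    (D : MapGraph.PlaneDrawing G) :
    ∃ (pt : V → ℂ) (θ : V → V → V → ℂ), Function.Injective pt ∧
      IsLogChange G pt Set.univ θ := by
  classical
  let φ : EuclideanSpace ℝ (Fin 2) → ℂ := fun x => ⟨x 0, x 1⟩
  have hφc : Continuous φ := by
    have : φ = fun x => ((x 0 : ℝ) : ℂ) + ((x 1 : ℝ) : ℂ) * Complex.I := by
      funext x; apply Complex.ext <;> simp [φ]
    rw [this]; fun_prop
  have hφi : Function.Injective φ := by
    intro x y h
    ext i
    fin_cases i
    · exact congrArg Complex.re h
    · exact congrArg Complex.im h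
  -- Arcs belong to unordered pairs; `γ a b` is the arc directed from `a` to `b`, with an arbitrary
  -- value for non-adjacent pairs.
  have key : ∀ a b, ∃ γ : C(I, ℂ), ∀ h : G.Adj a b, γ 0 = φ (D.point a) ∧ γ 1 = φ (D.point b) ∧
      ∀ x, ∃ y, γ x = φ (D.arc ⟨s(a, b), h⟩ y) := by
    intro a b
    by_cases h : G.Adj a b
    · have he := D.arc_ends ⟨s(a, b), h⟩
      have hcont := D.arc_continuous ⟨s(a, b), h⟩
      simp only [Sym2.map_mk, Sym2.eq_iff] at he
      rcases he with he | he
      · exact ⟨⟨fun x => φ (D.arc ⟨s(a, b), h⟩ x), by fun_prop⟩, fun _ => ⟨by simp [he.1],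
          by simp [he.2], fun x => ⟨x, rfl⟩⟩⟩
      · exact ⟨⟨fun x => φ (D.arc ⟨s(a, b), h⟩ (σ x)), by fun_prop⟩, fun _ => ⟨by simp [he.2],
          by simp [he.1], fun x => ⟨σ x, rfl⟩⟩⟩
    · exact ⟨0, fun h' => absurd h' h⟩
  choose γ hγ using key
  have hends : ∀ a b (h : G.Adj a b) x, x = 0 ∨ x = 1 →
      D.arc ⟨s(a, b), h⟩ x = D.point a ∨ D.arc ⟨s(a, b), h⟩ x = D.point b := by
    intro a b h x hx
    have he := D.arc_ends ⟨s(a, b), h⟩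
    simp only [Sym2.map_mk, Sym2.eq_iff] at he
    rcases hx with rfl | rfl <;> tauto
  have hav : ∀ a b (h : G.Adj a b) v x, v ≠ a → v ≠ b → γ a b x ≠ φ (D.point v) := by
    intro a b h v x hva hvb heq
    obtain ⟨y, hy⟩ := (hγ a b h).2.2 x
    have h1 : D.arc ⟨s(a, b), h⟩ y = D.point v := hφi (hy ▸ heq)
    rcases hends a b h y (D.arc_avoids_points _ _ _ h1) with h2 | h2
    · exact hva (D.point_injective (h1.symm.trans h2))
    · exact hvb (D.point_injective (h1.symm.trans h2))
  refine ⟨fun v => φ (D.point v), fun v a b => logChange (fun x => γ a b x - φ (D.point v)),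
    hφi.comp D.point_injective, ?_, ?_⟩
  · intro a b h v _ hva hvb
    have := exp_logChange (γ a b - ContinuousMap.const _ (φ (D.point v)))
      (fun x => by simpa [sub_ne_zero] using hav a b h v x hva hvb)
    simp only [ContinuousMap.sub_apply, ContinuousMap.const_apply, (hγ a b h).1,
      (hγ a b h).2.1] at this
    exact this
  · intro a b c d h h' hac had hbc hbd
    have := logChange_square (γ a b) (γ c d) (by
      intro x y hxy
      obtain ⟨x', hx'⟩ := (hγ a b h).2.2 x
      obtain ⟨y', hy'⟩ := (hγ c d h').2.2 y
      have heq : D.arc ⟨s(a, b), h⟩ x' = D.arc ⟨s(c, d), h'⟩ y' := hφi (by rw [← hx', ← hy', hxy])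
      have hne : (⟨s(a, b), h⟩ : G.edgeSet) ≠ ⟨s(c, d), h'⟩ := by
        intro he
        have := congrArg Subtype.val he
        simp only [Sym2.eq_iff] at this
        tauto
      rcases hends a b h x' (D.arc_avoids_arcs _ _ hne _ _ heq) with h2 | h2
      · exact hav c d h' a y hac had (by rw [hy', ← heq, h2])
      · exact hav c d h' b y hbc hbd (by rw [hy', ← heq, h2]))
    simpa only [(hγ a b h).1, (hγ a b h).2.1, (hγ c d h').1, (hγ c d h').2.1] using this

end LogChange

/-! ### Graphs with even crossings are sparse -/

namespace IsLogChange

variable {V : Type*} {H : SimpleGraph V} {pt : V → ℂ} {A : Set V} {θ : V → V → V → ℂ}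

theorem mono {H' : SimpleGraph V} {A' : Set V} (hθ : IsLogChange H pt A θ) (h : H' ≤ H)
    (hA : A' ⊆ A) : IsLogChange H' pt A' θ where
  exp_mul a b hab v hv := hθ.exp_mul a b (h hab) v (hA hv)
  crossing a b c d hab hcd := hθ.crossing a b c d (h hab) (h hcd)

/-- The complete graph on five vertices has no drawing with even crossings. -/
theorem not_complete_five (hθ : IsLogChange H pt A θ) (hpt : Function.Injective pt)
    (v : Fin 5 → V) (hv : Function.Injective v) (hvA : ∀ i, v i ∈ A)
    (hadj : ∀ i j, i ≠ j → H.Adj (v i) (v j)) : False := by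
  have hpi : (Real.pi : ℂ) * Complex.I ≠ 0 := by simp [Real.pi_ne_zero]
  let L : Fin 5 → Fin 5 → ℂ := fun i j => Complex.log (pt (v j) - pt (v i))
  have hne : ∀ i j, i ≠ j → pt (v j) - pt (v i) ≠ 0 := fun i j h =>
    sub_ne_zero.2 fun h' => h (hv (hpt h')).symm
  have hL : ∀ i j, i ≠ j → Complex.exp (L i j) = pt (v j) - pt (v i) := fun i j h =>
    Complex.exp_log (hne i j h)
  have hn : ∀ i a b, ∃ n : ℤ, i ≠ a → i ≠ b → a ≠ b →
      θ (v i) (v a) (v b) = L i b - L i a + n * (2 * (Real.pi * Complex.I)) := by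
    intro i a b
    by_cases h : i ≠ a ∧ i ≠ b ∧ a ≠ b
    · have h1 := hθ.exp_mul _ _ (hadj a b h.2.2) (v i) (hvA i) (hv.ne h.1) (hv.ne h.2.1)
      have h2 : Complex.exp (θ (v i) (v a) (v b)) = Complex.exp (L i b - L i a) := by
        rw [Complex.exp_sub, hL i b h.2.1, hL i a h.1, ← h1, mul_div_cancel_right₀ _ (hne i a h.1)]
      obtain ⟨n, hn⟩ := Complex.exp_eq_exp_iff_exists_int.1 h2
      exact ⟨n, fun _ _ _ => by rw [hn]; ring⟩
    · exact ⟨0, fun h1 h2 h3 => absurd ⟨h1, h2, h3⟩ h⟩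
  -- Logarithms of opposite numbers differ by an odd multiple of πi; this oddness is the
  -- obstruction.
  have hm : ∀ i j, ∃ m : ℤ, i ≠ j → L j i = L i j + (2 * m + 1) * (Real.pi * Complex.I) := by
    intro i j
    by_cases h : i = j
    · exact ⟨0, fun h' => absurd h h'⟩
    · have h2 : Complex.exp (L j i) = Complex.exp (L i j + Real.pi * Complex.I) := by
        rw [Complex.exp_add, hL i j h, hL j i (Ne.symm h), Complex.exp_pi_mul_I]; ring
      obtain ⟨n, hn⟩ := Complex.exp_eq_exp_iff_exists_int.1 h2
      exact ⟨n, fun _ => by rw [hn]; ring⟩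
  choose n hn using hn
  choose m hm using hm
  have key : ∀ a b c d, a ≠ b → c ≠ d → a ≠ c → a ≠ d → b ≠ c → b ≠ d →
      m b c - m a c - m b d + m a d + n c a b - n d a b + n b c d - n a c d = 0 := by
    intro a b c d hab hcd hac had hbc hbd
    have h := hθ.crossing _ _ _ _ (hadj a b hab) (hadj c d hcd) (hv.ne hac) (hv.ne had)
      (hv.ne hbc) (hv.ne hbd)
    rw [hn c a b hac.symm hbc.symm hab, hn d a b had.symm hbd.symm hab, hn b c d hbc hbd hcd,
      hn a c d hac had hcd, hm b c hbc, hm a c hac, hm b d hbd, hm a d had] at h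
    have h' : ((m b c - m a c - m b d + m a d + n c a b - n d a b + n b c d - n a c d : ℤ) : ℂ)
        * (2 * (Real.pi * Complex.I)) = 0 := by
      push_cast
      linear_combination h
    have h2 : (2 * (Real.pi * Complex.I) : ℂ) ≠ 0 := mul_ne_zero two_ne_zero hpi
    exact_mod_cast (mul_eq_zero.1 h').resolve_right h2
  have hanti : ∀ i j, i ≠ j → m j i = - m i j - 1 := by
    intro i j h
    have h1 := hm i j h
    rw [hm j i (Ne.symm h)] at h1
    have h' : ((m i j + m j i + 1 : ℤ) : ℂ) * (2 * (Real.pi * Complex.I)) = 0 := by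
      push_cast
      linear_combination -h1
    have h2 : (2 * (Real.pi * Complex.I) : ℂ) ≠ 0 := mul_ne_zero two_ne_zero hpi
    have h3 : m i j + m j i + 1 = 0 := by
      exact_mod_cast (mul_eq_zero.1 h').resolve_right h2
    omega
  -- These are the fifteen pairs of disjoint edges. Add the identities modulo 2: every `n` occurs
  -- twice and every unordered pair of indices of `m` six times, but `hanti` contributes 1 for each
  -- `m j i` with `j > i`. Each of the five 4-subsets yields three of these, so the total is 15,
  -- which is odd.
  have e1 := key 0 1 2 3 (by decide) (by decide) (by decide) (by decide) (by decide) (by decide)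
  have e2 := key 0 2 1 3 (by decide) (by decide) (by decide) (by decide) (by decide) (by decide)
  have e3 := key 0 3 1 2 (by decide) (by decide) (by decide) (by decide) (by decide) (by decide)
  have e4 := key 0 1 2 4 (by decide) (by decide) (by decide) (by decide) (by decide) (by decide)
  have e5 := key 0 2 1 4 (by decide) (by decide) (by decide) (by decide) (by decide) (by decide)
  have e6 := key 0 4 1 2 (by decide) (by decide) (by decide) (by decide) (by decide) (by decide)
  have e7 := key 0 1 3 4 (by decide) (by decide) (by decide) (by decide) (by decide) (by decide)
  have e8 := key 0 3 1 4 (by decide) (by decide) (by decide) (by decide) (by decide) (by decide)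
  have e9 := key 0 4 1 3 (by decide) (by decide) (by decide) (by decide) (by decide) (by decide)
  have e10 := key 0 2 3 4 (by decide) (by decide) (by decide) (by decide) (by decide) (by decide)
  have e11 := key 0 3 2 4 (by decide) (by decide) (by decide) (by decide) (by decide) (by decide)
  have e12 := key 0 4 2 3 (by decide) (by decide) (by decide) (by decide) (by decide) (by decide)
  have e13 := key 1 2 3 4 (by decide) (by decide) (by decide) (by decide) (by decide) (by decide)
  have e14 := key 1 3 2 4 (by decide) (by decide) (by decide) (by decide) (by decide) (by decide)
  have e15 := key 1 4 2 3 (by decide) (by decide) (by decide) (by decide) (by decide) (by decide)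
  have a1 := hanti 1 2 (by decide)
  have a2 := hanti 1 3 (by decide)
  have a3 := hanti 2 3 (by decide)
  have a4 := hanti 1 4 (by decide)
  have a5 := hanti 2 4 (by decide)
  have a6 := hanti 3 4 (by decide)
  clear hanti key hm hn
  omega

end IsLogChange

/-! ### Contraction of an edge -/

namespace SimpleGraph

variable {V : Type*}

/-- The graph that arises by identifying `y` with `x`. -/
def mergeInto (H : SimpleGraph V) (x y : V) : SimpleGraph V where
  Adj p q := p ≠ q ∧ p ≠ y ∧ q ≠ y ∧ (H.Adj p q ∨ (p = x ∧ H.Adj y q) ∨ (q = x ∧ H.Adj p y))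
  symm := ⟨fun p q h => ⟨h.1.symm, h.2.2.1, h.2.1, by
    rcases h.2.2.2 with h | h | h
    · exact Or.inl h.symm
    · exact Or.inr (Or.inr ⟨h.1, h.2.symm⟩)
    · exact Or.inr (Or.inl ⟨h.1, h.2.symm⟩)⟩⟩
  loopless := ⟨fun p h => h.1 rfl⟩

/-- Contraction loses the edge itself and, for each common neighbour, one of two edges that become
parallel. -/
theorem ncard_edgeSet_le_mergeInto [Finite V] (H : SimpleGraph V) {x y : V} (hxy : H.Adj x y) :
    H.edgeSet.ncard ≤ (H.mergeInto x y).edgeSet.ncard + 1 + (H.neighborSet x ∩ H.neighborSet y).ncard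
    := by
  classical
  set D : Set V := (H.neighborSet y \ H.neighborSet x) \ {x} with hD
  have h1 : H.edgeSet ⊆ ((H.mergeInto x y).edgeSet \ (fun q => s(x, q)) '' D) ∪
      (fun q => s(y, q)) '' H.neighborSet y := by
    intro e
    induction e with
    | h p q =>
    intro he
    rw [mem_edgeSet] at he
    by_cases hp : p = y
    · subst hp; exact Or.inr ⟨q, he, rfl⟩
    by_cases hq : q = y
    · subst hq; exact Or.inr ⟨p, he.symm, Sym2.eq_swap⟩
    refine Or.inl ⟨⟨he.ne, hp, hq, Or.inl he⟩, ?_⟩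
    rintro ⟨r, ⟨⟨-, hr⟩, -⟩, hre⟩
    have : H.Adj x r := by
      rw [← mem_edgeSet]
      simp only at hre
      rw [hre]; exact he
    exact hr this
  have h2 : (fun q => s(x, q)) '' D ⊆ (H.mergeInto x y).edgeSet := by
    rintro _ ⟨q, ⟨⟨hq, -⟩, hqx⟩, rfl⟩
    exact ⟨fun h => hqx h.symm, hxy.ne, (H.ne_of_adj hq).symm, Or.inr (Or.inl ⟨rfl, hq⟩)⟩
  have h3 : ((fun q => s(x, q)) '' D).ncard = D.ncard :=
    Set.ncard_image_of_injective _ fun a b h => Sym2.congr_right.1 h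
  have h4 : ((fun q => s(y, q)) '' H.neighborSet y).ncard ≤ (H.neighborSet y).ncard :=
    Set.ncard_image_le
  have h5 : H.neighborSet y ⊆ (D ∪ {x}) ∪ (H.neighborSet x ∩ H.neighborSet y) := by
    intro q hq
    by_cases hqx : q = x
    · exact Or.inl (Or.inr hqx)
    by_cases hqn : q ∈ H.neighborSet x
    · exact Or.inr ⟨hqn, hq⟩
    · exact Or.inl (Or.inl ⟨⟨hq, hqn⟩, hqx⟩)
  have h6 := (Set.ncard_le_ncard h1).trans (Set.ncard_union_le _ _)
  have h7 := (Set.ncard_le_ncard h5).trans (Set.ncard_union_le _ _)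
  have h8 := Set.ncard_union_le D {x}
  have h9 := Set.ncard_sdiff_add_ncard_of_subset h2
  rw [Set.ncard_singleton] at h8
  omega

end SimpleGraph

/-- An edge that `x` inherits from `y` is drawn along the path through `y`. Logarithmic changes add
up along the path, so its crossing identities are sums of two old ones. -/
theorem IsLogChange.mergeInto {V : Type*} {H : SimpleGraph V} {pt : V → ℂ} {A : Set V}
    {θ : V → V → V → ℂ} (hθ : IsLogChange H pt A θ) {x y : V} (hxy : H.Adj x y) :
    ∃ θ', IsLogChange (H.mergeInto x y) pt (A \ {y}) θ' := by
  classical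
  refine ⟨fun v p q => if H.Adj p q then θ v p q else
    if p = x then θ v x y + θ v y q else θ v p y + θ v y x, ?_, ?_⟩
  · rintro p q ⟨hpq, hpy, hqy, h⟩ v ⟨hv, hvy⟩ hvp hvq
    have hvy : v ≠ y := hvy
    by_cases hH : H.Adj p q
    · simpa [hH] using hθ.exp_mul p q hH v hv hvp hvq
    by_cases hpx : p = x
    · subst hpx
      have hyq : H.Adj y q := by
        rcases h with h | h | h
        · exact absurd h hH
        · exact h.2
        · exact absurd h.1.symm hpq
      simp only [if_neg hH, if_true]
      rw [← hθ.exp_mul y q hyq v hv hvy hvq, ← hθ.exp_mul p y hxy v hv hvp hvy, Complex.exp_add]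
      ring
    · have hqx : q = x ∧ H.Adj p y := by tauto
      obtain ⟨rfl, hpy'⟩ := hqx
      simp only [if_neg hH, if_neg hpx]
      rw [← hθ.exp_mul y q hxy.symm v hv hvy hvq, ← hθ.exp_mul p y hpy' v hv hvp hvy,
        Complex.exp_add]
      ring
  · have hold : ∀ p q, (H.mergeInto x y).Adj p q → ∀ c d, H.Adj c d → p ≠ c → p ≠ d → q ≠ c →
        q ≠ d → c ≠ y → d ≠ y →
        (if H.Adj p q then θ c p q else if p = x then θ c x y + θ c y q else θ c p y + θ c y x)
        - (if H.Adj p q then θ d p q else if p = x then θ d x y + θ d y q else θ d p y + θ d y x)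
        + θ q c d - θ p c d = 0 := by
      rintro p q ⟨hpq, hpy, hqy, h⟩ c d hcd hpc hpd hqc hqd hcy hdy
      by_cases hH : H.Adj p q
      · simpa [hH] using hθ.crossing p q c d hH hcd hpc hpd hqc hqd
      by_cases hpx : p = x
      · subst hpx
        have hyq : H.Adj y q := by
          rcases h with h | h | h
          · exact absurd h hH
          · exact h.2
          · exact absurd h.1.symm hpq
        simp only [if_neg hH, if_true]
        linear_combination hθ.crossing y q c d hyq hcd hcy.symm hdy.symm hqc hqd +
          hθ.crossing p y c d hxy hcd hpc hpd hcy.symm hdy.symm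
      · have hqx : q = x ∧ H.Adj p y := by tauto
        obtain ⟨rfl, hpy'⟩ := hqx
        simp only [if_neg hH, if_neg hpx]
        linear_combination hθ.crossing y q c d hxy.symm hcd hcy.symm hdy.symm hqc hqd +
          hθ.crossing p y c d hpy' hcd hpc hpd hcy.symm hdy.symm
    intro a b c d hab hcd hac had hbc hbd
    by_cases hH : H.Adj c d
    · have := hold a b hab c d hH hac had hbc hbd hcd.2.1 hcd.2.2.1
      simpa [hH] using this
    -- All inherited edges end at `x`, so of two independent edges at least one is old.
    · have hH' : H.Adj a b := by
        obtain ⟨-, -, -, h1⟩ := hab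
        obtain ⟨-, -, -, h2⟩ := hcd
        by_contra hcon
        rcases h1 with h1 | h1 | h1
        · exact hcon h1
        all_goals
          rcases h2 with h2 | h2 | h2
          · exact hH h2
          all_goals
            first
            | exact hac (h1.1.trans h2.1.symm)
            | exact had (h1.1.trans h2.1.symm)
            | exact hbc (h1.1.trans h2.1.symm)
            | exact hbd (h1.1.trans h2.1.symm)
      have := hold c d hcd a b hH' hac.symm hbc.symm had.symm hbd.symm hab.2.1 hab.2.2.1
      simp only [if_pos hH']
      linear_combination -this

namespace SimpleGraph

theorem sum_ncard_neighborSet {V : Type*} [Finite V] (H : SimpleGraph V) (A : Finset V)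
    (hA : ∀ a b, H.Adj a b → a ∈ A) :
    ∑ v ∈ A, (H.neighborSet v).ncard = 2 * H.edgeSet.ncard := by
  classical
  have := Fintype.ofFinite V
  have h := H.sum_degrees_eq_twice_card_edges
  rw [Set.ncard_eq_toFinset_card' H.edgeSet, Set.toFinset_card, ← edgeFinset_card, ← h]
  rw [← Finset.sum_subset (Finset.subset_univ A)]
  · refine Finset.sum_congr rfl fun v _ => ?_
    rw [Set.ncard_eq_toFinset_card', Set.toFinset_card, card_neighborSet_eq_degree]
  · intro v _ hv
    rw [degree_eq_zero]
    exact fun w hw => hv (hA v w hw)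

theorem exists_le_ncard_edgeSet_eq {V : Type*} [Finite V] (H : SimpleGraph V) (m : ℕ)
    (hm : m ≤ H.edgeSet.ncard) : ∃ H' ≤ H, H'.edgeSet.ncard = m := by
  obtain ⟨t, ht, hcard⟩ := Set.exists_subset_card_eq hm
  refine ⟨fromEdgeSet t, ?_, ?_⟩
  · rw [fromEdgeSet_le]
    exact Set.sdiff_subset.trans ht
  · rw [edgeSet_fromEdgeSet, ← hcard]
    congr 1
    refine sdiff_eq_left.2 (Set.disjoint_left.2 fun e he hd => ?_)
    exact H.not_isDiag_of_mem_edgeSet (ht he) hd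

end SimpleGraph

/-! ### Mader's bound on the number of edges -/

namespace IsLogChange

variable {V : Type*} {H : SimpleGraph V} {pt : V → ℂ} {θ : V → V → V → ℂ}

theorem not_adj_five {A : Set V} (hθ : IsLogChange H pt A θ) (hpt : Function.Injective pt)
    {a b c d e : V} (ha : a ∈ A) (hb : b ∈ A) (hc : c ∈ A) (hd : d ∈ A) (he : e ∈ A)
    (hab : H.Adj a b) (hac : H.Adj a c) (had : H.Adj a d) (hae : H.Adj a e) (hbc : H.Adj b c)
    (hbd : H.Adj b d) (hbe : H.Adj b e) (hcd : H.Adj c d) (hce : H.Adj c e) (hde : H.Adj d e) :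
    False := by
  have hadj : ∀ i j, i ≠ j → H.Adj (![a, b, c, d, e] i) (![a, b, c, d, e] j) := by
    intro i j
    fin_cases i <;> fin_cases j <;> simp [*, H.adj_comm b a, H.adj_comm c a, H.adj_comm c b,
      H.adj_comm d a, H.adj_comm d b, H.adj_comm d c, H.adj_comm e a, H.adj_comm e b,
      H.adj_comm e c, H.adj_comm e d]
  refine hθ.not_complete_five hpt ![a, b, c, d, e] ?_ ?_ hadj
  · intro i j hij
    by_contra hne
    have := hadj i j hne
    rw [hij] at this
    exact H.loopless.irrefl _ this
  · intro i
    fin_cases i <;> simpa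

/-- The neighbourhood `N` of `v` has four or five vertices, each with at least three neighbours in
`N`. Hence `v` and `N` contain a complete graph on five vertices, possibly after one contraction. -/
theorem false_of_common_neighbors {A : Set V} [Finite V] (hθ : IsLogChange H pt A θ)
    (hpt : Function.Injective pt) (hA : ∀ a b, H.Adj a b → a ∈ A)
    (hcom : ∀ x y, H.Adj x y → 3 ≤ (H.neighborSet x ∩ H.neighborSet y).ncard) {v : V}
    (hne : (H.neighborSet v).Nonempty) (hv : (H.neighborSet v).ncard ≤ 5) : False := by
  set N := H.neighborSet v with hN
  have hmem : ∀ u ∈ N, H.Adj v u := fun u hu => hu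
  have hcomN : ∀ u ∈ N, 3 ≤ (N ∩ H.neighborSet u).ncard := fun u hu => hcom v u hu
  have h4 : 4 ≤ N.ncard := by
    obtain ⟨u, hu⟩ := hne
    have h1 : N ∩ H.neighborSet u ⊆ N \ {u} := fun w hw => ⟨hw.1, (H.ne_of_adj hw.2).symm⟩
    have h2 := Set.ncard_le_ncard h1
    have h3 := hcomN u hu
    have h5 := Set.ncard_sdiff_singleton_of_mem hu
    omega
  have hvA : v ∈ A := hA _ _ hne.some_mem
  have hNA : ∀ u ∈ N, u ∈ A := fun u hu => hA _ _ (hmem u hu).symm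
  by_cases hclique : ∀ a ∈ N, ∀ b ∈ N, a ≠ b → H.Adj a b
  · obtain ⟨t, ht, hcard⟩ := Set.exists_subset_card_eq h4
    obtain ⟨a, b, c, d, hab, hac, had, hbc, hbd, hcd, rfl⟩ := Set.ncard_eq_four.1 hcard
    have ha : a ∈ N := ht (by simp)
    have hb : b ∈ N := ht (by simp)
    have hc : c ∈ N := ht (by simp)
    have hd : d ∈ N := ht (by simp)
    exact hθ.not_adj_five hpt hvA (hNA a ha) (hNA b hb) (hNA c hc) (hNA d hd) ha hb hc hd
      (hclique a ha b hb hab) (hclique a ha c hc hac) (hclique a ha d hd had)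
      (hclique b hb c hc hbc) (hclique b hb d hd hbd) (hclique c hc d hd hcd)
  · push Not at hclique
    obtain ⟨a, ha, b, hb, hab, hnab⟩ := hclique
    -- Non-adjacent `a`, `b` need three neighbours each among at most three remaining vertices, so
    -- both are joined to all of `R`.
    set R := (N \ {a}) \ {b} with hR
    have hRcard : R.ncard + 2 = N.ncard := by
      have h1 := Set.ncard_sdiff_singleton_of_mem ha
      have h2 := Set.ncard_sdiff_singleton_of_mem (show b ∈ N \ {a} from ⟨hb, hab.symm⟩)
      rw [hR]; omega
    have hRa : N ∩ H.neighborSet a ⊆ R := fun w hw =>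
      ⟨⟨hw.1, (H.ne_of_adj hw.2).symm⟩, fun h => hnab (h ▸ hw.2)⟩
    have hRb : N ∩ H.neighborSet b ⊆ R := fun w hw =>
      ⟨⟨hw.1, fun h => hnab (h ▸ hw.2 : H.Adj b a).symm⟩, (H.ne_of_adj hw.2).symm⟩
    have hea : N ∩ H.neighborSet a = R := Set.eq_of_subset_of_ncard_le hRa
      (by have := hcomN a ha; omega)
    have heb : N ∩ H.neighborSet b = R := Set.eq_of_subset_of_ncard_le hRb
      (by have := hcomN b hb; omega)
    have hR3 : R.ncard = 3 := by
      have := hcomN a ha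
      rw [hea] at this; omega
    have key : ∀ c d m, c ∈ R → d ∈ R → m ∈ R → c ≠ d → c ≠ m → d ≠ m → H.Adj d m → False := by
      intro c d m hc hd hm hcd hcm hdm hadj
      have ha' : ∀ x ∈ R, H.Adj a x := fun x hx => (hea ▸ hx : x ∈ N ∩ H.neighborSet a).2
      have hb' : ∀ x ∈ R, H.Adj b x := fun x hx => (heb ▸ hx : x ∈ N ∩ H.neighborSet b).2
      -- Contracting `c` into `b` creates the missing edge between `a` and `b`.
      obtain ⟨θ', hθ'⟩ := hθ.mergeInto (hb' c hc)
      have hold : ∀ p q, H.Adj p q → p ≠ c → q ≠ c → (H.mergeInto b c).Adj p q :=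
        fun p q h hp hq => ⟨h.ne, hp, hq, Or.inl h⟩
      have hac : a ≠ c := fun h => hc.1.2 h.symm
      have hbc : b ≠ c := fun h => hc.2 h.symm
      have hvc : v ≠ c := (H.ne_of_adj (hmem c hc.1.1))
      refine hθ'.not_adj_five hpt (a := b) (b := a) (c := d) (d := m) (e := v)
        ⟨hNA b hb, hbc⟩ ⟨hNA a ha, hac⟩ ⟨hNA d hd.1.1, hcd.symm⟩ ⟨hNA m hm.1.1, hcm.symm⟩
        ⟨hvA, hvc⟩ ⟨hab.symm, hbc, hac, Or.inr (Or.inl ⟨rfl, (ha' c hc).symm⟩)⟩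
        (hold _ _ (hb' d hd) hbc hcd.symm) (hold _ _ (hb' m hm) hbc hcm.symm)
        (hold _ _ (hmem b hb).symm hbc hvc) (hold _ _ (ha' d hd) hac hcd.symm)
        (hold _ _ (ha' m hm) hac hcm.symm) (hold _ _ (hmem a ha).symm hac hvc)
        (hold _ _ hadj hcd.symm hcm.symm) (hold _ _ (hmem d hd.1.1).symm hcd.symm hvc)
        (hold _ _ (hmem m hm.1.1).symm hcm.symm hvc)
    obtain ⟨c, d, m, hcd, hcm, hdm, hRe⟩ := Set.ncard_eq_three.1 hR3
    have hc : c ∈ R := by rw [hRe]; simp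
    have hd : d ∈ R := by rw [hRe]; simp
    have hm : m ∈ R := by rw [hRe]; simp
    have hcc : ¬ H.Adj c d → ¬ H.Adj c m → False := by
      intro h1 h2
      have h3 : N ∩ H.neighborSet c ⊆ {a, b} := by
        intro w hw
        by_contra hwab
        simp only [Set.mem_insert_iff, Set.mem_singleton_iff, not_or] at hwab
        have hwR : w ∈ R := ⟨⟨hw.1, hwab.1⟩, hwab.2⟩
        rw [hRe] at hwR
        rcases hwR with rfl | rfl | rfl
        · exact H.loopless.irrefl _ hw.2
        · exact h1 hw.2
        · exact h2 hw.2
      have h4 := Set.ncard_le_ncard h3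
      have h5 := hcomN c hc.1.1
      rw [Set.ncard_pair hab] at h4
      omega
    by_cases h1 : H.Adj c d
    · exact key m c d hm hc hd hcm.symm hdm.symm hcd h1
    by_cases h2 : H.Adj c m
    · exact key d c m hd hc hm hcd.symm hdm hcm h2
    exact hcc h1 h2

/-- Contracting an edge with at most two common neighbours loses at most three edges, which the
induction affords. If no such edge exists, a vertex of degree at most 5 contradicts
`false_of_common_neighbors`. -/
theorem ncard_edgeSet_add_six_le [Finite V] (hpt : Function.Injective pt) (n : ℕ) :
    ∀ (A : Finset V) (H : SimpleGraph V) (θ : V → V → V → ℂ), A.card = n →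
      (∀ a b, H.Adj a b → a ∈ A) → IsLogChange H pt A θ → 3 ≤ n →
      H.edgeSet.ncard + 6 ≤ 3 * n := by
  classical
  induction n with
  | zero => intros; omega
  | succ n ih =>
    intro A H₀ θ hcard hA₀ hθ₀ hn
    by_contra hcon
    -- Thinning a counterexample to one edge above the bound keeps its average degree below 6.
    obtain ⟨H, hle, hE⟩ := H₀.exists_le_ncard_edgeSet_eq (3 * (n + 1) - 5) (by omega)
    have hA : ∀ a b, H.Adj a b → a ∈ A := fun a b h => hA₀ a b (hle h)
    have hθ := hθ₀.mono hle subset_rfl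
    have hsum := H.sum_ncard_neighborSet A hA
    have hdeg : ∀ v ∈ A, (H.neighborSet v).ncard ≤ n := by
      intro v hv
      have h1 : H.neighborSet v ⊆ (A.erase v : Finset V) := fun w hw => by
        simp only [Finset.coe_erase, Set.mem_sdiff, Set.mem_singleton_iff]
        exact ⟨hA _ _ (hw : H.Adj v w).symm, (H.ne_of_adj hw).symm⟩
      have h2 := Set.ncard_le_ncard h1
      rw [Set.ncard_coe_finset, Finset.card_erase_of_mem hv, hcard] at h2
      exact h2
    by_cases hn4 : n ≤ 3
    · have h1 := Finset.sum_le_sum hdeg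
      rw [hsum, Finset.sum_const, hcard, smul_eq_mul] at h1
      interval_cases n <;> omega
    obtain ⟨v, hv, hv5⟩ : ∃ v ∈ A, (H.neighborSet v).ncard ≤ 5 := by
      by_contra hc
      push Not at hc
      have h1 := Finset.card_nsmul_le_sum A (fun v => (H.neighborSet v).ncard) 6
        (fun v hv => hc v hv)
      rw [hsum, hcard, smul_eq_mul] at h1
      omega
    refine hθ.false_of_common_neighbors hpt hA ?_ ?_ hv5
    · intro x y hxy
      by_contra hlt
      obtain ⟨θ', hθ'⟩ := hθ.mergeInto hxy
      have h1 := ih (A.erase y) (H.mergeInto x y) θ'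
        (by rw [Finset.card_erase_of_mem (hA _ _ hxy.symm), hcard]; rfl) (by
          rintro a b ⟨-, hay, hby, h⟩
          refine Finset.mem_erase.2 ⟨hay, ?_⟩
          rcases h with h | h | h
          · exact hA _ _ h
          · exact h.1 ▸ hA _ _ hxy
          · exact hA _ _ h.2) (by simpa using hθ') (by omega)
      have h2 := H.ncard_edgeSet_le_mergeInto hxy
      omega
    · by_contra hemp
      rw [Set.not_nonempty_iff_eq_empty] at hemp
      have hno : ∀ w, ¬ H.Adj v w := fun w hw => by
        have : w ∈ H.neighborSet v := hw
        rw [hemp] at this; exact this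
      have h1 := ih (A.erase v) H θ (by rw [Finset.card_erase_of_mem hv, hcard]; rfl)
        (fun a b h => Finset.mem_erase.2 ⟨fun e => hno b (e ▸ h), hA _ _ h⟩)
        (hθ.mono le_rfl (by simp)) (by omega)
      omega

theorem sum_ncard_neighborSet_le [Finite V] (hpt : Function.Injective pt) (A : Finset V)
    (hA : ∀ a b, H.Adj a b → a ∈ A) (hθ : IsLogChange H pt A θ) :
    ∑ v ∈ A, (H.neighborSet v).ncard ≤ 6 * A.card := by
  classical
  by_cases h3 : 3 ≤ A.card
  · have := ncard_edgeSet_add_six_le hpt A.card A H θ rfl hA hθ h3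
    rw [H.sum_ncard_neighborSet A hA]
    omega
  · have h1 : ∀ v ∈ A, (H.neighborSet v).ncard ≤ 6 := by
      intro v _
      have h1 : H.neighborSet v ⊆ A := fun w hw => hA _ _ (hw : H.Adj v w).symm
      have h2 := Set.ncard_le_ncard h1
      rw [Set.ncard_coe_finset] at h2
      omega
    have := Finset.sum_le_card_nsmul A _ 6 h1
    rw [smul_eq_mul] at this
    omega

end IsLogChange

/-! ### Closed curves that pairwise meet in at most one vertex -/

/-- The sum of the logarithmic changes, seen from `v`, over the first `m` edges of the walk `F`. -/
def pathSum {V : Type*} (θ : V → V → V → ℂ) (F : ℕ → V) (m : ℕ) (v : V) : ℂ :=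
  ∑ j ∈ Finset.range m, θ v (F j) (F (j + 1))

/-- The first two terms telescope in `l`, the last two in `j`. For two closed walks the boundary
terms cancel, whatever `θ` is. -/
theorem sum_crossing_eq {V : Type*} (θ : V → V → V → ℂ) (F G : ℕ → V) (m n : ℕ) :
    ∑ j ∈ Finset.range m, ∑ l ∈ Finset.range n,
      (θ (G l) (F j) (F (j + 1)) - θ (G (l + 1)) (F j) (F (j + 1))
        + θ (F (j + 1)) (G l) (G (l + 1)) - θ (F j) (G l) (G (l + 1))) =
    pathSum θ F m (G 0) - pathSum θ F m (G n) + pathSum θ G n (F m) - pathSum θ G n (F 0) := by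
  have h1 : ∀ j, ∑ l ∈ Finset.range n,
      (θ (G l) (F j) (F (j + 1)) - θ (G (l + 1)) (F j) (F (j + 1))) =
      θ (G 0) (F j) (F (j + 1)) - θ (G n) (F j) (F (j + 1)) := fun j =>
    Finset.sum_range_sub' (fun l => θ (G l) (F j) (F (j + 1))) n
  have h2 : ∀ l, ∑ j ∈ Finset.range m,
      (θ (F (j + 1)) (G l) (G (l + 1)) - θ (F j) (G l) (G (l + 1))) =
      θ (F m) (G l) (G (l + 1)) - θ (F 0) (G l) (G (l + 1)) := fun l =>
    Finset.sum_range_sub (fun j => θ (F j) (G l) (G (l + 1))) m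
  calc _ = (∑ j ∈ Finset.range m, ∑ l ∈ Finset.range n,
      (θ (G l) (F j) (F (j + 1)) - θ (G (l + 1)) (F j) (F (j + 1)))) +
      ∑ j ∈ Finset.range m, ∑ l ∈ Finset.range n,
      (θ (F (j + 1)) (G l) (G (l + 1)) - θ (F j) (G l) (G (l + 1))) := by
        simp only [← Finset.sum_add_distrib]
        refine Finset.sum_congr rfl fun j _ => Finset.sum_congr rfl fun l _ => ?_
        ring
    _ = _ := by
        rw [Finset.sum_comm (s := Finset.range m) (t := Finset.range n)
          (f := fun j l => θ (F (j + 1)) (G l) (G (l + 1)) - θ (F j) (G l) (G (l + 1)))]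
        simp only [h1, h2, Finset.sum_sub_distrib, pathSum]
        ring

/-- `f` runs periodically, with period `L`, through a closed walk without repeated vertices. -/
structure IsClosedCurve {V : Type*} (B : SimpleGraph V) (f : ℤ → V) (L : ℕ) : Prop where
  pos : 0 < L
  eq_iff : ∀ a b, f a = f b ↔ (L : ℤ) ∣ a - b
  adj : ∀ a, B.Adj (f a) (f (a + 1))

/-- The stretch of length `m` that starts at position `p` of the curve `f` joins two distinct
vertices of `X` and meets `X` only in them. -/
structure IsSegment {V : Type*} (X : Set V) (f : ℤ → V) (L : ℕ) (p : ℤ) (m : ℕ) : Prop where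
  pos : 0 < m
  lt : m < L
  start_mem : f p ∈ X
  end_mem : f (p + m) ∈ X
  interior : ∀ j : ℕ, 0 < j → j < m → f (p + j) ∉ X

namespace IsClosedCurve

variable {V : Type*} {B : SimpleGraph V} {f g : ℤ → V} {L M : ℕ} {X : Set V}

theorem eq_of_lt (hf : IsClosedCurve B f L) {p : ℤ} {a b : ℕ} (h : f (p + a) = f (p + b))
    (ha : a ≤ L) (hb : 0 < b) (hb' : b < L) : a = b := by
  have h1 := (hf.eq_iff _ _).1 h
  have h2 : (L : ℤ) ∣ (a : ℤ) - b := by convert h1 using 1; ring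
  have h3 := Int.eq_zero_of_abs_lt_dvd h2 (by rw [abs_lt]; constructor <;> omega)
  omega

theorem _root_.IsSegment.start_ne_end (hf : IsClosedCurve B f L) {p : ℤ} {m : ℕ}
    (h : IsSegment X f L p m) : f p ≠ f (p + m) := by
  intro he
  have := hf.eq_of_lt (p := p) (a := 0) (b := m) (by simpa using he) (Nat.zero_le _) h.pos h.lt
  have := h.pos
  omega

theorem _root_.IsSegment.eq_end {p : ℤ} {m j : ℕ} (h : IsSegment X f L p m) (hj : j ≤ m)
    (hX : f (p + j) ∈ X) : j = 0 ∨ j = m := by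
  by_contra hcon
  exact h.interior j (by omega) (by omega) hX

theorem exists_isSegment (hf : IsClosedCurve B f L) {a b : ℤ} (ha : f a ∈ X) (hb : f b ∈ X)
    (hne : f a ≠ f b) : ∃ m, IsSegment X f L a m := by
  classical
  have hL : (L : ℤ) ≠ 0 := by exact_mod_cast hf.pos.ne'
  have hex : ∃ m : ℕ, 0 < m ∧ m < L ∧ f (a + m) ∈ X := by
    have h0 := Int.emod_nonneg (b - a) hL
    have h1 := Int.emod_lt_of_pos (b - a) (by exact_mod_cast hf.pos : (0 : ℤ) < L)
    have h2 : f (a + ((b - a) % L).toNat) = f b := by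
      rw [hf.eq_iff, Int.toNat_of_nonneg h0, Int.emod_def]
      exact ⟨-((b - a) / L), by ring⟩
    refine ⟨((b - a) % L).toNat, Nat.pos_of_ne_zero fun h => hne ?_, by omega, h2 ▸ hb⟩
    rw [← h2, h]; simp
  have hm := Nat.find_spec hex
  refine ⟨Nat.find hex, hm.1, hm.2.1, ha, hm.2.2, fun j hj hlt hX => ?_⟩
  exact Nat.find_min hex hlt ⟨hj, hlt.trans hm.2.1, hX⟩

/-- Two segments without a common end cross algebraically zero times if the curves that they belong
to are equal or have at most one common vertex. -/
theorem crossing_segments {θ : V → V → V → ℂ} {pt : V → ℂ} {A : Set V}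
    (hθ : IsLogChange B pt A θ) (hf : IsClosedCurve B f L) (hg : IsClosedCurve B g M)
    (hfg : (f = g ∧ L = M) ∨ ∀ a b a' b', f a = g b → f a' = g b' → f a = f a')
    {p q : ℤ} {m n : ℕ} (hp : IsSegment X f L p m) (hq : IsSegment X g M q n)
    (h00 : f p ≠ g q) (h01 : f p ≠ g (q + n)) (h10 : f (p + m) ≠ g q)
    (h11 : f (p + m) ≠ g (q + n)) :
    pathSum θ (fun j => f (p + j)) m (g q) - pathSum θ (fun j => f (p + j)) m (g (q + n))
      + pathSum θ (fun j => g (q + j)) n (f (p + m)) - pathSum θ (fun j => g (q + j)) n (f p)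
      = 0 := by
  have hzero : ∀ j l : ℕ, f (p + j) ≠ g (q + l) → f (p + j) ≠ g (q + (l + 1 : ℕ)) →
      f (p + (j + 1 : ℕ)) ≠ g (q + l) → f (p + (j + 1 : ℕ)) ≠ g (q + (l + 1 : ℕ)) →
      θ (g (q + l)) (f (p + j)) (f (p + (j + 1 : ℕ)))
        - θ (g (q + (l + 1 : ℕ))) (f (p + j)) (f (p + (j + 1 : ℕ)))
        + θ (f (p + (j + 1 : ℕ))) (g (q + l)) (g (q + (l + 1 : ℕ)))
        - θ (f (p + j)) (g (q + l)) (g (q + (l + 1 : ℕ))) = 0 := by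
    intro j l h1 h2 h3 h4
    refine hθ.crossing _ _ _ _ ?_ ?_ h1 h2 h3 h4
    · have := hf.adj (p + j)
      rwa [add_assoc] at this
    · have := hg.adj (q + l)
      rwa [add_assoc] at this
  have hsum := sum_crossing_eq θ (fun j => f (p + j)) (fun j => g (q + j)) m n
  simp only [Nat.cast_zero, add_zero] at hsum
  rw [← hsum]
  by_cases hdisj : ∀ j l : ℕ, j ≤ m → l ≤ n → f (p + j) ≠ g (q + l)
  · refine Finset.sum_eq_zero fun j hj => Finset.sum_eq_zero fun l hl => ?_
    rw [Finset.mem_range] at hj hl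
    exact hzero j l (hdisj _ _ (by omega) (by omega)) (hdisj _ _ (by omega) (by omega))
      (hdisj _ _ (by omega) (by omega)) (hdisj _ _ (by omega) (by omega))
  push Not at hdisj
  obtain ⟨j₀, l₀, hj₀, hl₀, heq⟩ := hdisj
  have hnX : f (p + j₀) ∉ X := by
    intro hX
    rcases hp.eq_end hj₀ hX with rfl | rfl <;>
    rcases hq.eq_end hl₀ (heq ▸ hX) with rfl | rfl <;> simp_all
  have hj1 : 0 < j₀ := Nat.pos_of_ne_zero fun h => hnX (by simpa [h] using hp.start_mem)
  have hj2 : j₀ < m := lt_of_le_of_ne hj₀ fun h => hnX (by simpa [h] using hp.end_mem)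
  have hl1 : 0 < l₀ := Nat.pos_of_ne_zero fun h =>
    hnX (heq ▸ by simpa [h] using hq.start_mem)
  have hl2 : l₀ < n := lt_of_le_of_ne hl₀ fun h => hnX (heq ▸ by simpa [h] using hq.end_mem)
  rcases hfg with ⟨rfl, rfl⟩ | hshare
  -- On one curve, stretches with a common interior vertex are overlapping translates: either they
  -- start together, or one starts inside the other, at a vertex of `X`.
  · exfalso
    have hshift : ∀ l : ℤ, f (p + j₀ - l₀ + l) = f (q + l) := by
      intro l
      rw [hf.eq_iff]
      convert (hf.eq_iff _ _).1 heq using 1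
      ring
    rcases lt_trichotomy j₀ l₀ with h | h | h
    · refine hq.interior (l₀ - j₀) (by omega) (by omega) ?_
      rw [← hshift, Nat.cast_sub h.le]
      convert hp.start_mem using 2
      ring
    · refine h00 ?_
      rw [← add_zero q, ← hshift, h]
      congr 1
      ring
    · refine hp.interior (j₀ - l₀) (by omega) (by omega) ?_
      rw [Nat.cast_sub h.le]
      convert hq.start_mem using 1
      rw [← add_zero q, ← hshift]
      congr 1
      ring
  -- Over full periods the sum vanishes. The only common vertex is interior to both segments, so
  -- every pair of edges outside their product is independent and contributes zero.
  · have hfull := sum_crossing_eq θ (fun j => f (p + j)) (fun j => g (q + j)) L M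
    have hfL : f (p + L) = f (p + (0 : ℕ)) := (hf.eq_iff _ _).2 ⟨1, by simp⟩
    have hgM : g (q + M) = g (q + (0 : ℕ)) := (hg.eq_iff _ _).2 ⟨1, by simp⟩
    simp only [hfL, hgM, sub_self, zero_add] at hfull
    rw [← Finset.sum_product'] at hfull ⊢
    rw [← hfull]
    refine Finset.sum_subset (Finset.product_subset_product ?_ ?_) ?_
    · exact Finset.range_subset_range.2 hp.lt.le
    · exact Finset.range_subset_range.2 hq.lt.le
    · rintro ⟨j, l⟩ h1 h2
      simp only [Finset.mem_product, Finset.mem_range, not_and_or, not_lt] at h1 h2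
      have key : ∀ a b : ℕ, (a = j ∨ a = j + 1) → (b = l ∨ b = l + 1) →
          f (p + a) ≠ g (q + b) := by
        intro a b ha hb hab
        have h3 := hf.eq_of_lt (hshare _ _ _ _ hab heq) (by omega) hj1 (hj2.trans hp.lt)
        have h4 : g (q + b) = g (q + l₀) := by
          rw [← hab, ← heq]; exact hshare _ _ _ _ hab heq
        have h5 := hg.eq_of_lt h4 (by omega) hl1 (hl2.trans hq.lt)
        omega
      exact hzero j l (key _ _ (by simp) (by simp)) (key _ _ (by simp) (by simp))
        (key _ _ (by simp) (by simp)) (key _ _ (by simp) (by simp))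

theorem exp_pathSum {θ : V → V → V → ℂ} {pt : V → ℂ} {A : Set V}
    (hθ : IsLogChange B pt A θ) (hf : IsClosedCurve B f L) (p : ℤ) (m : ℕ) {v : V} (hv : v ∈ A)
    (hav : ∀ j : ℕ, j ≤ m → f (p + j) ≠ v) :
    Complex.exp (pathSum θ (fun j => f (p + j)) m v) * (pt (f p) - pt v)
      = pt (f (p + m)) - pt v := by
  induction m with
  | zero => simp [pathSum]
  | succ m ih =>
    have h1 := ih fun j hj => hav j (by omega)
    have h2 := hθ.exp_mul (f (p + m)) (f (p + (m + 1 : ℕ)))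
      (by have := hf.adj (p + m); rwa [add_assoc] at this) v hv (hav m (by omega)).symm
      (hav (m + 1) le_rfl).symm
    have h3 : pathSum θ (fun j => f (p + j)) (m + 1) v = pathSum θ (fun j => f (p + j)) m v
        + θ v (f (p + m)) (f (p + (m + 1 : ℕ))) := Finset.sum_range_succ _ _
    rw [← h2, ← h1, h3, Complex.exp_add]
    ring

/-- In a family of closed curves of a planar graph that pairwise meet in at most one vertex, the
visits to a set `X` of vertices by curves that visit at least two vertices of `X` number at most
`6 * |X|`. -/
theorem ncard_visits_le [Finite V] (hB : MapGraph.IsPlanar B) {ι : Type*} (f : ι → ℤ → V)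
    (L : ι → ℕ) (hf : ∀ i, IsClosedCurve B (f i) (L i))
    (hshare : ∀ i i', i ≠ i' → ∀ a b a' b', f i a = f i' b → f i a' = f i' b' → f i a = f i a')
    (X : Finset V) :
    {z : ι × V | z.2 ∈ X ∧ (∃ a, f z.1 a = z.2) ∧ ∃ b, f z.1 b ∈ X ∧ f z.1 b ≠ z.2}.ncard
      ≤ 6 * X.card := by
  classical
  obtain ⟨D⟩ := hB
  obtain ⟨pt, θ, hpt, hθ⟩ := D.exists_isLogChange
  let R : V → V → (V → ℂ) → Prop := fun x y ψ => ∃ i p m, IsSegment (X : Set V) (f i) (L i) p m ∧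
    ((f i p = x ∧ f i (p + m) = y ∧ ∀ v, ψ v = pathSum θ (fun j => f i (p + j)) m v) ∨
     (f i p = y ∧ f i (p + m) = x ∧ ∀ v, ψ v = -pathSum θ (fun j => f i (p + j)) m v))
  have hRX : ∀ x y ψ, R x y ψ → x ∈ X ∧ x ≠ y := by
    rintro x y ψ ⟨i, p, m, h, ⟨rfl, rfl, -⟩ | ⟨rfl, rfl, -⟩⟩
    · exact ⟨h.start_mem, h.start_ne_end (hf i)⟩
    · exact ⟨h.end_mem, (h.start_ne_end (hf i)).symm⟩
  let H : SimpleGraph V :=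
    { Adj := fun x y => ∃ ψ, R x y ψ
      symm := ⟨by
        rintro x y ⟨ψ, i, p, m, h, h' | h'⟩
        · exact ⟨-ψ, i, p, m, h, Or.inr ⟨h'.1, h'.2.1, fun v => by simp [h'.2.2 v]⟩⟩
        · exact ⟨-ψ, i, p, m, h, Or.inl ⟨h'.1, h'.2.1, fun v => by simp [h'.2.2 v]⟩⟩⟩
      loopless := ⟨fun x ⟨ψ, h⟩ => (hRX x x ψ h).2 rfl⟩ }
  have hθ' : ∃ θ', IsLogChange H pt (X : Set V) θ' := by
    -- Several segments may join the same two vertices; one of them is chosen to draw the edge.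
    have hex : ∀ x y, ∃ ψ, H.Adj x y → R x y ψ := by
      intro x y
      by_cases h : H.Adj x y
      · exact ⟨h.choose, fun _ => h.choose_spec⟩
      · exact ⟨0, fun h' => absurd h' h⟩
    choose ψ hψ using hex
    refine ⟨fun v x y => ψ x y v, ?_, ?_⟩
    · intro a b hab v hv hva hvb
      obtain ⟨i, p, m, h, h'⟩ := hψ a b hab
      have hne : v ≠ f i p ∧ v ≠ f i (p + m) := by
        rcases h' with ⟨h1, h2, -⟩ | ⟨h1, h2, -⟩ <;> rw [h1, h2] <;> tauto
      have hexp := (hf i).exp_pathSum hθ p m (Set.mem_univ v) (by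
        rintro j hj rfl
        rcases h.eq_end hj hv with rfl | rfl
        · exact hne.1 (by simp)
        · exact hne.2 rfl)
      rcases h' with ⟨h1, h2, h3⟩ | ⟨h1, h2, h3⟩ <;> rw [h1, h2] at hexp <;> simp only [h3]
      · exact hexp
      · rw [← hexp, ← mul_assoc, ← Complex.exp_add]; simp
    · intro a b c d hab hcd hac had hbc hbd
      obtain ⟨i, p, m, h, h'⟩ := hψ a b hab
      obtain ⟨i', q, n, g, g'⟩ := hψ c d hcd
      have hfg : (f i = f i' ∧ L i = L i') ∨
          ∀ a b a' b', f i a = f i' b → f i a' = f i' b' → f i a = f i a' := by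
        by_cases hi : i = i'
        · subst hi; exact Or.inl ⟨rfl, rfl⟩
        · exact Or.inr (hshare i i' hi)
      have key := crossing_segments hθ (hf i) (hf i') hfg h g
      rcases h' with ⟨h1, h2, h3⟩ | ⟨h1, h2, h3⟩ <;> rcases g' with ⟨g1, g2, g3⟩ | ⟨g1, g2, g3⟩ <;>
        rw [h1, h2, g1, g2] at key <;> simp only [h3, g3]
      · linear_combination key hac had hbc hbd
      · linear_combination -key had hac hbd hbc
      · linear_combination -key hbc hbd hac had
      · linear_combination key hbd hbc had hac
  obtain ⟨θ', hθ'⟩ := hθ'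
  have hbound := IsLogChange.sum_ncard_neighborSet_le (H := H) hpt X
    (fun a b ⟨ψ, h⟩ => (hRX a b ψ h).1) hθ'
  refine le_trans ?_ hbound
  -- A visit is sent to the directed edge from its vertex to the next vertex of `X` on the curve.
  -- Different curves give different directed edges, since they cannot share both ends.
  have hsucc : ∀ z : ι × V, ∃ y, (z.2 ∈ X ∧ (∃ a, f z.1 a = z.2) ∧
      ∃ b, f z.1 b ∈ X ∧ f z.1 b ≠ z.2) → H.Adj z.2 y ∧ ∃ b, f z.1 b = y := by
    rintro ⟨i, x⟩
    by_cases h : x ∈ X ∧ (∃ a, f i a = x) ∧ ∃ b, f i b ∈ X ∧ f i b ≠ x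
    · obtain ⟨hx, ⟨a, rfl⟩, b, hb, hne⟩ := h
      obtain ⟨m, hm⟩ := (hf i).exists_isSegment (X := (X : Set V)) hx hb hne.symm
      exact ⟨f i (a + m), fun _ => ⟨⟨_, i, a, m, hm, Or.inl ⟨rfl, rfl, fun v => rfl⟩⟩, _, rfl⟩⟩
    · exact ⟨x, fun h' => absurd h' h⟩
  choose s hs using hsucc
  have hcard : ∑ x ∈ X, (H.neighborSet x).ncard =
      (((X.sigma fun x => (H.neighborSet x).toFinite.toFinset) :
        Finset (Σ _ : V, V)) : Set (Σ _ : V, V)).ncard := by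
    rw [Set.ncard_coe_finset, Finset.card_sigma]
    exact Finset.sum_congr rfl fun x _ => Set.ncard_eq_toFinset_card _ _
  rw [hcard]
  refine Set.ncard_le_ncard_of_injOn (fun z => ⟨z.2, s z⟩) ?_ ?_ (Finset.finite_toSet _)
  · intro z hz
    simp only [Finset.coe_sigma, Set.Finite.coe_toFinset]
    exact ⟨hz.1, (hs z hz).1⟩
  · rintro ⟨i, x⟩ hz ⟨i', x'⟩ hz' heq
    simp only [Sigma.mk.injEq, heq_eq_eq] at heq
    obtain ⟨rfl, hy⟩ := heq
    have h1 := hs _ hz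
    have h2 := hs _ hz'
    obtain ⟨-, ⟨a, ha⟩, -⟩ := hz
    obtain ⟨-, ⟨a', ha'⟩, -⟩ := hz'
    obtain ⟨b, hb⟩ := h1.2
    obtain ⟨b', hb'⟩ := h2.2
    by_contra hne
    have hii : i ≠ i' := fun h => hne (by rw [h])
    simp only at ha ha' hb hb'
    have h3 := hshare i i' hii a a' b b' (ha.trans ha'.symm) (by rw [hb, hb', hy])
    exact H.ne_of_adj h1.1 (ha.symm.trans (h3.trans hb))

end IsClosedCurve

/-! ### Cycles in graphs -/

namespace SimpleGraph.Walk

variable {V : Type*} {G : SimpleGraph V}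

/-- A cycle, read off as a periodic sequence. -/
theorem IsCycle.exists_periodic {u : V} {w : G.Walk u u} (hw : w.IsCycle) :
    ∃ g : ℤ → V, (∀ a b, g a = g b ↔ (w.length : ℤ) ∣ a - b) ∧
      (∀ a, s(g a, g (a + 1)) ∈ w.edges) ∧ ∀ e ∈ w.edges, ∃ a, e = s(g a, g (a + 1)) := by
  have h3 := hw.three_le_length
  set n := w.length with hn
  have hn0 : (n : ℤ) ≠ 0 := by omega
  have hr0 : ∀ a : ℤ, 0 ≤ a % n := fun a => Int.emod_nonneg a hn0
  have hr1 : ∀ a : ℤ, a % n < n := fun a => Int.emod_lt_of_pos a (by omega)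
  have hsucc : ∀ a : ℤ, w.getVert ((a + 1) % n).toNat = w.getVert ((a % n).toNat + 1) := by
    intro a
    by_cases h : a % n + 1 = n
    · have h1 : (a + 1) % n = 0 := by
        rw [← Int.emod_add_emod, h, Int.emod_self]
      have h2 : (a % n).toNat + 1 = n := by have := hr0 a; omega
      rw [h1, h2, hn, getVert_length]; simp
    · have h1 : (a + 1) % n = a % n + 1 := by
        rw [← Int.emod_add_emod]
        exact Int.emod_eq_of_lt (by have := hr0 a; omega) (by have := hr1 a; omega)
      rw [h1, Int.toNat_add (hr0 a) zero_le_one]; rfl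
  refine ⟨fun a => w.getVert (a % n).toNat, fun a b => ?_, fun a => ?_, fun e he => ?_⟩
  · rw [← Int.emod_eq_emod_iff_emod_sub_eq_zero.trans Int.dvd_iff_emod_eq_zero.symm]
    refine ⟨fun h => ?_, fun h => by simp only [h]⟩
    have h1 := hw.getVert_injOn' (by have := hr1 a; simp only [Set.mem_ofPred_eq]; omega)
      (by have := hr1 b; simp only [Set.mem_ofPred_eq]; omega) h
    have := hr0 a
    have := hr0 b
    omega
  · beta_reduce
    rw [hsucc, mk_mem_edges_iff_exists]
    exact ⟨(a % n).toNat, by have := hr0 a; have := hr1 a; omega, rfl⟩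
  · induction e with
    | h x y =>
    obtain ⟨i, hi, hxy⟩ := (mk_mem_edges_iff_exists w).1 he
    refine ⟨i, ?_⟩
    beta_reduce
    rw [hsucc, Int.emod_eq_of_lt (by omega) (by omega), Int.toNat_natCast, hxy]

/-- A chord of a cycle yields a shorter cycle. -/
theorem IsCycle.exists_shorter_of_chord {u : V} {w : G.Walk u u} (hw : w.IsCycle) {x y : V}
    (hx : x ∈ w.support) (hy : y ∈ w.support) (hxy : G.Adj x y) (hchord : s(x, y) ∉ w.edges) :
    ∃ (b : V) (p : G.Walk b b), p.IsCycle ∧ p.length < w.length ∧ p.support ⊆ w.support := by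
  classical
  set c := w.rotate x hx with hc
  have hcc : c.IsCycle := (isCycle_rotate hx).2 hw
  have hyc : y ∈ c.support := (mem_support_rotate_iff w x hx).2 hy
  have hedge : s(x, y) ∉ c.edges := fun h => hchord ((rotate_edges w x hx).mem_iff.1 h)
  have hsub : (c.takeUntil y hyc).edges ⊆ c.edges := edges_takeUntil_subset_edges c hyc
  refine ⟨y, cons hxy.symm (c.takeUntil y hyc), ?_, ?_, ?_⟩
  · rw [cons_isCycle_iff]
    refine ⟨hcc.isPath_takeUntil hyc, fun h => hedge ?_⟩
    rw [Sym2.eq_swap]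
    exact hsub h
  · have h1 : (c.takeUntil y hyc).length + (c.dropUntil y hyc).length = c.length := by
      rw [← length_append, take_spec]
    have h2 : c.length = w.length := length_rotate w x hx
    have h3 : (c.dropUntil y hyc).edges ⊆ c.edges := edges_dropUntil_subset_edges c hyc
    rw [length_cons]
    -- The discarded part has length at least 2, as `x` and `y` are distinct and not joined by an
    -- edge of the cycle.
    have h4 : 2 ≤ (c.dropUntil y hyc).length := by
      rcases hq : c.dropUntil y hyc with _ | ⟨h, q⟩
      · exact absurd hxy (G.loopless.irrefl _)
      · rcases q with _ | ⟨h', q⟩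
        · rw [hq] at h3
          exact absurd (h3 (by simp [Sym2.eq_swap])) hedge
        · simp
    omega
  · intro z hz
    rw [support_cons, List.mem_cons] at hz
    rcases hz with rfl | hz
    · exact hy
    · exact (mem_support_rotate_iff w x hx).1 (support_takeUntil_subset_support c hyc hz)

theorem exists_triangle {x y z : V} (hxy : G.Adj x y) (hyz : G.Adj y z) (hxz : G.Adj x z) :
    ∃ (b : V) (p : G.Walk b b), p.IsCycle ∧ p.length = 3 ∧
      ∀ v, v ∈ p.support ↔ v = x ∨ v = y ∨ v = z := by
  refine ⟨x, cons hxy (cons hyz (cons hxz.symm nil)), ?_, rfl, fun v => ?_⟩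
  · rw [cons_isCycle_iff]
    have h1 := hxy.ne
    have h2 := hyz.ne
    have h3 := hxz.ne
    constructor
    · simp [cons_isPath_iff, h1.symm, h2, h3.symm]
    · simp [h1, h1.symm, h2, h3]
  · simp only [support_cons, support_nil, List.mem_cons, List.not_mem_nil, or_false]
    tauto

theorem IsCycle.card_support_toFinset [DecidableEq V] {u : V} {w : G.Walk u u} (hw : w.IsCycle) :
    w.support.toFinset.card = w.length := by
  have h1 : w.support.toFinset = w.support.tail.toFinset := by
    ext v
    rw [List.mem_toFinset, List.mem_toFinset]
    refine ⟨fun h => ?_, List.mem_of_mem_tail⟩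
    rw [mem_support_iff] at h
    rcases h with rfl | h
    · exact end_mem_tail_support hw.not_nil
    · exact h
  rw [h1, List.toFinset_card_of_nodup hw.support_nodup, List.length_tail, length_support]
  rfl

end SimpleGraph.Walk

/-! ### Grouping into triples along a laminar family -/

/-- `X` separates two elements of `P`. -/
def Splits {α : Type*} (X P : Set α) : Prop :=
  (∃ u ∈ P, u ∈ X) ∧ ∃ v ∈ P, v ∉ X

open Classical in
-- Take the first triple inside a smallest set with at least three elements among `M` and the traces
-- of the family on `M`. By laminarity, a set that splits this triple has at most two elements of
-- `M`. Removing the triple lowers that number, so the bound by `min 2` of the trace size passes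
-- through the induction.
theorem exists_triples {α τ ι : Type*} (F : τ → Set α)
    (hF : ∀ t t', F t ⊆ F t' ∨ F t' ⊆ F t ∨ Disjoint (F t) (F t')) (J : Finset ι) :
    ∀ M : Finset α, M.card = 3 * J.card → ∃ P : ι → Finset α,
      (∀ i ∈ J, P i ⊆ M ∧ (P i).card = 3) ∧ (∀ i ∈ J, ∀ j ∈ J, i ≠ j → Disjoint (P i) (P j)) ∧
      ∀ t, {i ∈ J | Splits (F t) (P i)}.card ≤ min 2 {x ∈ M | x ∈ F t}.card := by
  induction J using Finset.induction_on with
  | empty => exact fun M _ => ⟨fun _ => ∅, by simp⟩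
  | insert i₀ J hi₀ ih =>
    intro M hM
    rw [Finset.card_insert_of_notMem hi₀] at hM
    let 𝒜 : Finset (Finset α) := {A ∈ M.powerset | 3 ≤ A.card ∧
      (A = M ∨ ∃ t, A = {x ∈ M | x ∈ F t})}
    have hne : 𝒜.Nonempty := ⟨M, by simp [𝒜]; omega⟩
    obtain ⟨A, hA, hmin⟩ := Finset.exists_min_image 𝒜 Finset.card hne
    simp only [𝒜, Finset.mem_filter, Finset.mem_powerset] at hA
    obtain ⟨hAM, hA3, hAF⟩ := hA
    obtain ⟨Q, hQA, hQ⟩ := Finset.exists_subset_card_eq hA3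
    have hQM := hQA.trans hAM
    obtain ⟨P, hP, hPd, hPs⟩ := ih (M \ Q) (by rw [Finset.card_sdiff_of_subset hQM]; omega)
    have hsmall : ∀ t, Splits (F t) (Q : Set α) → {x ∈ M | x ∈ F t}.card ≤ 2 := by
      rintro t ⟨⟨u, huQ, huF⟩, v, hvQ, hvF⟩
      by_contra hlt
      have hmem : {x ∈ M | x ∈ F t} ∈ 𝒜 := by
        simp only [𝒜, Finset.mem_filter, Finset.mem_powerset]
        exact ⟨Finset.filter_subset _ _, by omega, Or.inr ⟨t, rfl⟩⟩
      have hle := hmin _ hmem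
      have hnot : ¬ {x ∈ M | x ∈ F t} ⊆ A := by
        intro hsub
        have := Finset.eq_of_subset_of_card_le hsub hle
        have hvA := hQA hvQ
        rw [← this, Finset.mem_filter] at hvA
        exact hvF hvA.2
      rcases hAF with rfl | ⟨t', rfl⟩
      · exact hnot (Finset.filter_subset _ _)
      · rcases hF t t' with h | h | h
        · exact hnot (Finset.monotone_filter_right _ fun x _ hx => h hx)
        · exact hvF (h (Finset.mem_filter.1 (hQA hvQ)).2)
        · exact Set.disjoint_left.1 h huF (Finset.mem_filter.1 (hQA huQ)).2
    have hne' : ∀ i ∈ J, i ≠ i₀ := fun i hi h => hi₀ (h ▸ hi)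
    refine ⟨Function.update P i₀ Q, ?_, ?_, ?_⟩
    · intro i hi
      rcases Finset.mem_insert.1 hi with rfl | hi
      · simpa using ⟨hQM, hQ⟩
      · rw [Function.update_of_ne (hne' i hi)]
        exact ⟨(hP i hi).1.trans Finset.sdiff_subset, (hP i hi).2⟩
    · have hdis : ∀ i ∈ J, Disjoint (P i) Q := fun i hi =>
        Finset.disjoint_of_subset_left (hP i hi).1 Finset.sdiff_disjoint
      intro i hi' j hj' hij
      rcases Finset.mem_insert.1 hi' with rfl | hi <;> rcases Finset.mem_insert.1 hj' with rfl | hj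
      · exact absurd rfl hij
      · rw [Function.update_self, Function.update_of_ne (hne' j hj)]
        exact (hdis j hj).symm
      · rw [Function.update_self, Function.update_of_ne (hne' i hi)]
        exact hdis i hi
      · rw [Function.update_of_ne (hne' i hi), Function.update_of_ne (hne' j hj)]
        exact hPd i hi j hj hij
    · intro t
      have hcongr : {i ∈ J | Splits (F t) (Function.update P i₀ Q i : Finset α)} =
          {i ∈ J | Splits (F t) (P i)} := by
        refine Finset.filter_congr fun i hi => ?_
        rw [Function.update_of_ne (hne' i hi)]
      have hsub : {x ∈ M \ Q | x ∈ F t} ⊆ {x ∈ M | x ∈ F t} :=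
        Finset.filter_subset_filter _ Finset.sdiff_subset
      have h1 := hPs t
      have h2 := Finset.card_le_card hsub
      rw [Finset.filter_insert, hcongr]
      split_ifs with hs
      · rw [Function.update_self] at hs
        have h3 := hsmall t hs
        have h4 : {x ∈ M \ Q | x ∈ F t} ⊂ {x ∈ M | x ∈ F t} := by
          obtain ⟨⟨u, huQ, huF⟩, -⟩ := hs
          refine (Finset.ssubset_iff_of_subset hsub).2 ⟨u, ?_, ?_⟩
          · exact Finset.mem_filter.2 ⟨hQM huQ, huF⟩
          · simp [Finset.mem_coe.1 huQ]
        have h5 := Finset.card_lt_card h4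
        have h6 := Finset.card_insert_le i₀ {i ∈ J | Splits (F t) (P i)}
        omega
      · omega

/-! ### Minimal cycle packings of half-squares -/

namespace MapGraph

variable {W S : Type*} {B : SimpleGraph (W ⊕ S)}

theorem halfSquare_adj_iff (hbip : B ≤ completeBipartiteGraph W S) {u v : W} :
    (halfSquare B).Adj u v ↔
      u ≠ v ∧ ∃ s, B.Adj (Sum.inl u) (Sum.inr s) ∧ B.Adj (Sum.inl v) (Sum.inr s) := by
  constructor
  · intro h
    refine ⟨h.ne, ?_⟩
    have h2 : B.dist (Sum.inl u) (Sum.inl v) = 2 := h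
    -- Unreachable pairs have `dist` equal to 0 by convention, so distance 2 implies reachability.
    have hr : B.Reachable (Sum.inl u) (Sum.inl v) := by
      by_contra hr
      rw [SimpleGraph.dist_eq_zero_of_not_reachable hr] at h2
      omega
    obtain ⟨p, hp⟩ := hr.exists_walk_length_eq_dist
    rw [h2] at hp
    rcases p with _ | ⟨h1, p⟩
    · simp at hp
    rename_i x
    rcases p with _ | ⟨h3, p⟩
    · simp at hp
    rcases p with _ | ⟨h4, p⟩
    · rcases x with x | s
      · exact absurd (hbip h1) (by simp)
      · exact ⟨s, h1, h3.symm⟩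
    · simp at hp
  · rintro ⟨hne, s, hu, hv⟩
    change B.dist (Sum.inl u) (Sum.inl v) = 2
    let p : B.Walk (Sum.inl u) (Sum.inl v) := .cons hu (.cons hv.symm .nil)
    have h1 : B.dist (Sum.inl u) (Sum.inl v) ≤ 2 := SimpleGraph.dist_le p
    have h2 : B.dist (Sum.inl u) (Sum.inl v) ≠ 0 := fun h0 => hne <| by
      simpa using (p.reachable.dist_eq_zero_iff).1 h0
    have h3 : B.dist (Sum.inl u) (Sum.inl v) ≠ 1 := fun h0 =>
      absurd (hbip (SimpleGraph.dist_eq_one_iff_adj.1 h0)) (by simp)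
    omega

/-- A triangle all of whose vertices are neighbours of one special vertex. -/
def IsMono (B : SimpleGraph (W ⊕ S)) {b : W} (w : (halfSquare B).Walk b b) : Prop :=
  w.length = 3 ∧ ∃ s, ∀ u ∈ w.support, B.Adj (Sum.inl u) (Sum.inr s)

theorem exists_isMono (hbip : B ≤ completeBipartiteGraph W S) {x y z : W} {s : S}
    (hxy : x ≠ y) (hyz : y ≠ z) (hxz : x ≠ z) (hx : B.Adj (Sum.inl x) (Sum.inr s))
    (hy : B.Adj (Sum.inl y) (Sum.inr s)) (hz : B.Adj (Sum.inl z) (Sum.inr s)) :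
    ∃ (b : W) (p : (halfSquare B).Walk b b), p.IsCycle ∧ IsMono B p ∧
      ∀ v, v ∈ p.support ↔ v = x ∨ v = y ∨ v = z := by
  obtain ⟨b, p, hp, hl, hs⟩ := SimpleGraph.Walk.exists_triangle
    ((halfSquare_adj_iff hbip).2 ⟨hxy, s, hx, hy⟩) ((halfSquare_adj_iff hbip).2 ⟨hyz, s, hy, hz⟩)
    ((halfSquare_adj_iff hbip).2 ⟨hxz, s, hx, hz⟩)
  refine ⟨b, p, hp, ⟨hl, s, fun u hu => ?_⟩, hs⟩
  rcases (hs u).1 hu with rfl | rfl | rfl <;> assumption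

open Classical in
/-- The weight of a cycle: zero for a triangle at a special vertex, the length otherwise. -/
noncomputable def weight (B : SimpleGraph (W ⊕ S)) {b : W} (w : (halfSquare B).Walk b b) : ℕ :=
  if IsMono B w then 0 else w.length

theorem weight_eq_zero {b : W} {w : (halfSquare B).Walk b b} (hw : w.IsCycle) :
    weight B w = 0 ↔ IsMono B w := by
  have := hw.three_le_length
  unfold weight
  split_ifs with h
  · simp [h]
  · simp only [h, iff_false]; omega

theorem weight_le_length {b : W} (w : (halfSquare B).Walk b b) : weight B w ≤ w.length := by
  unfold weight
  split_ifs <;> omega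

/-- The weights of the cycles of a packing cannot be decreased simultaneously. -/
def IsMinimalPacking {k : ℕ} (C : CyclePacking (halfSquare B) k) : Prop :=
  ∀ c : Fin k → Σ v, (halfSquare B).Walk v v, (∀ i, (c i).2.IsCycle) →
    (∀ i j, i ≠ j → ∀ v, v ∈ (c i).2.support → v ∉ (c j).2.support) →
    (∀ i, weight B (c i).2 ≤ weight B (C.cycle i)) → ∀ i, weight B (c i).2 = weight B (C.cycle i)

theorem exists_isMinimalPacking {k : ℕ} (h : Nonempty (CyclePacking (halfSquare B) k)) :
    ∃ C : CyclePacking (halfSquare B) k, IsMinimalPacking C := by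
  let total : CyclePacking (halfSquare B) k → ℕ := fun C => ∑ i, weight B (C.cycle i)
  obtain ⟨C₀⟩ := h
  have hmem : sInf (Set.range total) ∈ Set.range total := Nat.sInf_mem ⟨_, C₀, rfl⟩
  obtain ⟨C, hC⟩ := hmem
  refine ⟨C, fun c hc hd hle i => le_antisymm (hle i) ?_⟩
  by_contra hlt
  have h1 : total ⟨fun i => (c i).1, fun i => (c i).2, hc, hd⟩ < total C :=
    Finset.sum_lt_sum (fun i _ => hle i) ⟨i, Finset.mem_univ i, not_le.1 hlt⟩
  rw [hC] at h1
  exact absurd h1 (not_lt.2 (Nat.sInf_le ⟨_, rfl⟩))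

namespace IsMinimalPacking

variable {k : ℕ} {C : CyclePacking (halfSquare B) k}

theorem weight_le (hC : IsMinimalPacking C) (i : Fin k) {b : W} {p : (halfSquare B).Walk b b}
    (hp : p.IsCycle) (hsub : p.support ⊆ (C.cycle i).support) :
    weight B (C.cycle i) ≤ weight B p := by
  classical
  by_contra hlt
  let c : Fin k → Σ v, (halfSquare B).Walk v v :=
    Function.update (fun j => ⟨_, C.cycle j⟩) i ⟨b, p⟩
  have hci : c i = ⟨b, p⟩ := Function.update_self ..
  have hcj : ∀ j, j ≠ i → c j = ⟨_, C.cycle j⟩ := fun j hj => Function.update_of_ne hj ..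
  have hsupp : ∀ j, (c j).2.support ⊆ (C.cycle j).support := by
    intro j
    by_cases h : j = i
    · subst h; rw [hci]; exact hsub
    · rw [hcj j h]; exact List.Subset.refl _
  have := hC c (fun j => by
      by_cases h : j = i
      · subst h; rw [hci]; exact hp
      · rw [hcj j h]; exact C.isCycle j)
    (fun j l hjl v hj hl => C.disjoint j l hjl v (hsupp j hj) (hsupp l hl))
    (fun j => by
      by_cases h : j = i
      · subst h; rw [hci]; exact (not_le.1 hlt).le
      · rw [hcj j h]) i
  rw [hci] at this
  exact hlt this.ge

/-- Two disjoint triangles of weight 0 can replace the cycles `i` and `j` without raising any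
weight, so minimality says that the weight of `i` was already 0. -/
theorem isMono_of_exchange (hC : IsMinimalPacking C) {i j : Fin k} (hij : i ≠ j) {b b' : W}
    {p : (halfSquare B).Walk b b} {q : (halfSquare B).Walk b' b'} (hp : p.IsCycle)
    (hq : q.IsCycle) (hpm : IsMono B p) (hqm : IsMono B q)
    (hps : ∀ v ∈ p.support, v ∈ (C.cycle i).support ∨ v ∈ (C.cycle j).support)
    (hqs : ∀ v ∈ q.support, v ∈ (C.cycle i).support ∨ v ∈ (C.cycle j).support)
    (hd : ∀ v ∈ p.support, v ∉ q.support) : IsMono B (C.cycle i) := by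
  classical
  let c : Fin k → Σ v, (halfSquare B).Walk v v := fun l =>
    if l = i then ⟨b, p⟩ else if l = j then ⟨b', q⟩ else ⟨_, C.cycle l⟩
  have hci : c i = ⟨b, p⟩ := if_pos rfl
  have hcj : c j = ⟨b', q⟩ := by simp [c, hij.symm]
  have hcl : ∀ l, l ≠ i → l ≠ j → c l = ⟨_, C.cycle l⟩ := fun l h h' => by simp [c, h, h']
  have hpw := (weight_eq_zero hp).2 hpm
  have hqw := (weight_eq_zero hq).2 hqm
  have hout : ∀ l, l ≠ i → l ≠ j → ∀ v, v ∈ (C.cycle i).support ∨ v ∈ (C.cycle j).support →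
      v ∉ (C.cycle l).support := by
    rintro l hi hj v (hv | hv)
    · exact C.disjoint i l hi.symm v hv
    · exact C.disjoint j l hj.symm v hv
  have := hC c (fun l => by
      by_cases h : l = i
      · subst h; rw [hci]; exact hp
      by_cases h' : l = j
      · subst h'; rw [hcj]; exact hq
      rw [hcl l h h']; exact C.isCycle l)
    (fun l m hlm v hl hm => by
      by_cases h : l = i
      · subst h
        rw [hci] at hl
        by_cases h' : m = j
        · subst h'; rw [hcj] at hm; exact hd v hl hm
        · rw [hcl m hlm.symm h'] at hm
          exact hout m hlm.symm h' v (hps v hl) hm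
      by_cases h' : l = j
      · subst h'
        rw [hcj] at hl
        by_cases h' : m = i
        · subst h'; rw [hci] at hm; exact hd v hm hl
        · rw [hcl m h' hlm.symm] at hm
          exact hout m h' hlm.symm v (hqs v hl) hm
      rw [hcl l h h'] at hl
      by_cases h1 : m = i
      · subst h1; rw [hci] at hm; exact hout l h h' v (hps v hm) hl
      by_cases h2 : m = j
      · subst h2; rw [hcj] at hm; exact hout l h h' v (hqs v hm) hl
      rw [hcl m h1 h2] at hm
      exact C.disjoint l m hlm v hl hm)
    (fun l => by
      by_cases h : l = i
      · subst h; rw [hci]; simp [hpw]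
      by_cases h' : l = j
      · subst h'; rw [hcj]; simp [hqw]
      rw [hcl l h h']) i
  rw [hci, hpw] at this
  exact (weight_eq_zero (C.isCycle i)).1 this.symm

/-- Every cycle of a minimal packing is induced. -/
theorem isInduced (hC : IsMinimalPacking C) : C.IsInduced := by
  intro i u hu v hv huv
  by_contra hch
  obtain ⟨b, p, hp, hlt, hsub⟩ := (C.isCycle i).exists_shorter_of_chord hu hv huv hch
  have h1 := hC.weight_le i hp hsub
  have h2 := hp.three_le_length
  have h3 := weight_le_length p
  unfold weight at h1
  split_ifs at h1 with h4 h5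
  · have := h4.1; omega
  · have := h4.1; omega
  · have := (C.isCycle i).three_le_length; omega
  · omega

/-- A special vertex has at most two neighbours on a cycle that is not a triangle at a special
vertex. -/
theorem not_three (hC : IsMinimalPacking C) (hbip : B ≤ completeBipartiteGraph W S) {i : Fin k}
    (hi : ¬ IsMono B (C.cycle i)) {x y z : W} {s : S} (hxi : x ∈ (C.cycle i).support)
    (hyi : y ∈ (C.cycle i).support) (hzi : z ∈ (C.cycle i).support)
    (hxy : x ≠ y) (hyz : y ≠ z) (hxz : x ≠ z) (hx : B.Adj (Sum.inl x) (Sum.inr s))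
    (hy : B.Adj (Sum.inl y) (Sum.inr s)) (hz : B.Adj (Sum.inl z) (Sum.inr s)) : False := by
  obtain ⟨b, p, hp, hpm, hs⟩ := exists_isMono hbip hxy hyz hxz hx hy hz
  have h1 := hC.weight_le i hp fun v hv => by
    rcases (hs v).1 hv with rfl | rfl | rfl <;> assumption
  rw [(weight_eq_zero hp).2 hpm, Nat.le_zero] at h1
  exact hi ((weight_eq_zero (C.isCycle i)).1 h1)

end IsMinimalPacking

/-- A cyclic sequence of vertices and a cyclic sequence of special vertices between them. -/
theorem isClosedCurve_of_labels {g : ℤ → W} {s : ℤ → S} {n : ℕ} (hn : 0 < n)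
    (hg : ∀ a b, g a = g b ↔ (n : ℤ) ∣ a - b) (hs : ∀ a b, s a = s b ↔ (n : ℤ) ∣ a - b)
    (hadj : ∀ a, B.Adj (Sum.inl (g a)) (Sum.inr (s a)) ∧
      B.Adj (Sum.inl (g (a + 1))) (Sum.inr (s a))) :
    ∃ f : ℤ → W ⊕ S, IsClosedCurve B f (2 * n) ∧ (∀ a, f (2 * a) = Sum.inl (g a)) ∧
      ∀ a, f (2 * a + 1) = Sum.inr (s a) := by
  let f : ℤ → W ⊕ S := fun z => if z % 2 = 0 then Sum.inl (g (z / 2)) else Sum.inr (s (z / 2))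
  have h0 : ∀ a, f (2 * a) = Sum.inl (g a) := fun a => by simp [f]
  have h1 : ∀ a, f (2 * a + 1) = Sum.inr (s a) := fun a => by
    have h : (2 * a + 1) / 2 = a := by omega
    simp [f, h]
  have hodd : ∀ a b : ℤ, ¬ ((2 * n : ℕ) : ℤ) ∣ 2 * a - (2 * b + 1) := by
    rintro a b ⟨c, hc⟩
    push_cast at hc
    have : 2 * a - (2 * b + 1) = 2 * (n * c) := by rw [hc]; ring
    omega
  have heven : ∀ a b : ℤ, ((2 * n : ℕ) : ℤ) ∣ 2 * a - 2 * b ↔ (n : ℤ) ∣ a - b := by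
    intro a b
    rw [← mul_sub, Nat.cast_mul, Nat.cast_two, mul_dvd_mul_iff_left two_ne_zero]
  refine ⟨f, ⟨by omega, fun a b => ?_, fun a => ?_⟩, h0, h1⟩
  · obtain ⟨a, rfl | rfl⟩ := Int.even_or_odd' a <;> obtain ⟨b, rfl | rfl⟩ := Int.even_or_odd' b
    · rw [h0, h0, heven, ← hg, Sum.inl.injEq]
    · rw [h0, h1]; simpa using hodd a b
    · rw [h0, h1]
      have := hodd b a
      rw [← dvd_neg, neg_sub] at this
      simpa using this
    · rw [h1, h1, add_sub_add_right_eq_sub, heven, ← hs, Sum.inr.injEq]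
  · obtain ⟨a, rfl | rfl⟩ := Int.even_or_odd' a
    · rw [h0, h1]; exact (hadj a).1
    · rw [h1, show 2 * a + 1 + 1 = 2 * (a + 1) by ring, h0]; exact (hadj a).2.symm

/-- Two different edges of a cyclic sequence: one has an end that is not an end of the other. -/
theorem exists_end_notMem {g : ℤ → W} {n : ℕ} (hn : 3 ≤ n)
    (hg : ∀ a b, g a = g b ↔ (n : ℤ) ∣ a - b) {a b : ℤ} (hab : g a ≠ g b) :
    ∃ x, (x = g b ∨ x = g (b + 1)) ∧ x ≠ g a ∧ x ≠ g (a + 1) := by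
  by_cases h : g b = g (a + 1)
  · refine ⟨g (b + 1), Or.inr rfl, fun h' => ?_, fun h' => ?_⟩
    · have h1 := (hg _ _).1 h
      have h2 := (hg _ _).1 h'
      have h4 := dvd_sub h2 h1
      rw [show b + 1 - a - (b - (a + 1)) = 2 by ring] at h4
      have := Int.le_of_dvd (by norm_num) h4
      omega
    · have h1 := (hg _ _).1 h'
      rw [add_sub_add_right_eq_sub, dvd_sub_comm] at h1
      exact hab ((hg _ _).2 h1)
  · exact ⟨g b, Or.inl rfl, hab.symm, h⟩

/-- The cycles of a minimal packing that are not triangles at a special vertex, as closed curves of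
the bipartite graph that pairwise meet at most once. -/
theorem IsMinimalPacking.exists_closedCurves {k : ℕ} {C : CyclePacking (halfSquare B) k}
    (hC : IsMinimalPacking C) (hbip : B ≤ completeBipartiteGraph W S) :
    ∃ (f : {i // ¬ IsMono B (C.cycle i)} → ℤ → W ⊕ S) (n : {i // ¬ IsMono B (C.cycle i)} → ℕ),
      (∀ i, IsClosedCurve B (f i) (2 * n i)) ∧
      (∀ i j, i ≠ j → ∀ a b a' b', f i a = f j b → f i a' = f j b' → f i a = f i a') ∧
      (∀ i, ∀ e ∈ (C.cycle i.1).edges, ∃ a u v s, e = s(u, v) ∧ f i (2 * a) = Sum.inl u ∧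
        f i (2 * a + 1) = Sum.inr s ∧ f i (2 * a + 2) = Sum.inl v) := by
  classical
  have hex : ∀ i : {i // ¬ IsMono B (C.cycle i)}, ∃ (g : ℤ → W) (s : ℤ → S) (n : ℕ), 3 ≤ n ∧
      (∀ a b, g a = g b ↔ (n : ℤ) ∣ a - b) ∧ (∀ a b, s a = s b ↔ (n : ℤ) ∣ a - b) ∧
      (∀ a, B.Adj (Sum.inl (g a)) (Sum.inr (s a)) ∧ B.Adj (Sum.inl (g (a + 1))) (Sum.inr (s a))) ∧
      (∀ a, g a ∈ (C.cycle i.1).support) ∧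
      ∀ e ∈ (C.cycle i.1).edges, ∃ a, e = s(g a, g (a + 1)) := by
    rintro ⟨i, hi⟩
    obtain ⟨g, hg, hge, he⟩ := (C.isCycle i).exists_periodic
    have hsupp : ∀ a, g a ∈ (C.cycle i).support := fun a =>
      SimpleGraph.Walk.fst_mem_support_of_mem_edges _ (hge a)
    have hlab : ∀ u v : W, ∃ s, (halfSquare B).Adj u v →
        B.Adj (Sum.inl u) (Sum.inr s) ∧ B.Adj (Sum.inl v) (Sum.inr s) := by
      intro u v
      by_cases h : (halfSquare B).Adj u v
      · obtain ⟨s, hs⟩ := ((halfSquare_adj_iff hbip).1 h).2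
        exact ⟨s, fun _ => hs⟩
      · obtain ⟨s, -⟩ := ((halfSquare_adj_iff hbip).1
          (SimpleGraph.Walk.adj_of_mem_edges _ (hge 0))).2
        exact ⟨s, fun h' => absurd h' h⟩
    choose lab hlab using hlab
    have hadj : ∀ a, B.Adj (Sum.inl (g a)) (Sum.inr (lab (g a) (g (a + 1)))) ∧
        B.Adj (Sum.inl (g (a + 1))) (Sum.inr (lab (g a) (g (a + 1)))) := fun a =>
      hlab _ _ (SimpleGraph.Walk.adj_of_mem_edges _ (hge a))
    refine ⟨g, fun a => lab (g a) (g (a + 1)), (C.cycle i).length, (C.isCycle i).three_le_length,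
      hg, fun a b => ⟨fun h => ?_, fun h => ?_⟩, hadj, hsupp, he⟩
    -- Equal labels on different edges would give one special vertex three neighbours on the cycle.
    · rw [← hg]
      by_contra hab
      obtain ⟨x, hx, hxa, hxa'⟩ := exists_end_notMem (C.isCycle i).three_le_length hg hab
      have hxs : x ∈ (C.cycle i).support ∧
          B.Adj (Sum.inl x) (Sum.inr (lab (g a) (g (a + 1)))) := by
        beta_reduce at h
        rw [h]
        rcases hx with rfl | rfl
        · exact ⟨hsupp _, (hadj b).1⟩
        · exact ⟨hsupp _, (hadj b).2⟩
      exact hC.not_three hbip hi (hsupp a) (hsupp (a + 1)) hxs.1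
        (SimpleGraph.Walk.adj_of_mem_edges _ (hge a)).ne hxa'.symm hxa.symm (hadj a).1 (hadj a).2
        hxs.2
    · have h1 : g a = g b := (hg _ _).2 h
      have h2 : g (a + 1) = g (b + 1) := (hg _ _).2 (by rwa [add_sub_add_right_eq_sub])
      simp only [h1, h2]
  choose g s n hn hg hs hadj hsupp he using hex
  have hcurve := fun i => isClosedCurve_of_labels (by have := hn i; omega) (hg i) (hs i) (hadj i)
  choose f hf hf0 hf1 using hcurve
  refine ⟨f, n, hf, ?_, ?_⟩
  · intro i j hij
    have hij' : i.1 ≠ j.1 := fun h => hij (Subtype.ext h)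
    -- The cycles are disjoint in `W`, so their curves can only meet in special vertices.
    have hodd : ∀ a b, f i a = f j b → ∃ c d, a = 2 * c + 1 ∧ b = 2 * d + 1 ∧ s i c = s j d := by
      intro a b hab
      obtain ⟨a, rfl | rfl⟩ := Int.even_or_odd' a <;>
      obtain ⟨b, rfl | rfl⟩ := Int.even_or_odd' b
      · rw [hf0, hf0, Sum.inl.injEq] at hab
        exact absurd (hab ▸ hsupp j b) (C.disjoint i.1 j.1 hij' _ (hsupp i a))
      · rw [hf0, hf1] at hab; cases hab
      · rw [hf0, hf1] at hab; cases hab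
      · rw [hf1, hf1, Sum.inr.injEq] at hab
        exact ⟨a, b, rfl, rfl, hab⟩
    intro a b a' b' h h'
    obtain ⟨a, b, rfl, rfl, hab⟩ := hodd _ _ h
    obtain ⟨a', b', rfl, rfl, hab'⟩ := hodd _ _ h'
    by_contra hne
    rw [hf1, hf1, Sum.inr.injEq] at hne
    have hga : g i a ≠ g i a' := fun hc => hne ((hs i _ _).2 ((hg i _ _).1 hc))
    have hgb : g j b' ≠ g j b := fun hc => hne (by
      rw [hab, hab']; exact ((hs j _ _).2 ((hg j _ _).1 hc)).symm)
    -- With two common special vertices, one takes an edge of cycle `i` and the vertex `y` of cycle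
    -- `j`, the other an edge of `j` and the vertex `x` of `i`. The choice of `x` and `y` makes
    -- these two triangles disjoint.
    obtain ⟨x, hx, hxa, hxa'⟩ := exists_end_notMem (hn i) (hg i) hga
    obtain ⟨y, hy, hyb, hyb'⟩ := exists_end_notMem (hn j) (hg j) hgb
    have hsucc : ∀ i a, g i a ≠ g i (a + 1) := by
      intro i a hc
      have h1 := (hg i _ _).1 hc
      rw [show a - (a + 1) = -1 by ring, dvd_neg] at h1
      have := Int.le_of_dvd one_pos h1
      have := hn i
      omega
    have hdis : ∀ u v, u ∈ (C.cycle i.1).support → v ∈ (C.cycle j.1).support → u ≠ v :=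
      fun u v hu hv huv => C.disjoint i.1 j.1 hij' u hu (huv ▸ hv)
    have hxs : x ∈ (C.cycle i.1).support ∧ B.Adj (Sum.inl x) (Sum.inr (s i a')) := by
      rcases hx with rfl | rfl
      · exact ⟨hsupp _ _, (hadj i a').1⟩
      · exact ⟨hsupp _ _, (hadj i a').2⟩
    have hys : y ∈ (C.cycle j.1).support ∧ B.Adj (Sum.inl y) (Sum.inr (s i a)) := by
      rw [hab]
      rcases hy with rfl | rfl
      · exact ⟨hsupp _ _, (hadj j b).1⟩
      · exact ⟨hsupp _ _, (hadj j b).2⟩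
    obtain ⟨c, p, hp, hpm, hps⟩ := exists_isMono hbip (hsucc i a)
      (hdis _ _ (hsupp i (a + 1)) hys.1) (hdis _ _ (hsupp i a) hys.1) (hadj i a).1 (hadj i a).2
      hys.2
    obtain ⟨d, q, hq, hqm, hqs⟩ := exists_isMono hbip (hdis _ _ hxs.1 (hsupp j b'))
      (hsucc j b') (hdis _ _ hxs.1 (hsupp j (b' + 1))) hxs.2 (hab' ▸ (hadj j b').1)
      (hab' ▸ (hadj j b').2)
    refine i.2 (hC.isMono_of_exchange hij' hp hq hpm hqm ?_ ?_ ?_)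
    · intro v hv
      rcases (hps v).1 hv with rfl | rfl | rfl
      · exact Or.inl (hsupp _ _)
      · exact Or.inl (hsupp _ _)
      · exact Or.inr hys.1
    · intro v hv
      rcases (hqs v).1 hv with rfl | rfl | rfl
      · exact Or.inl hxs.1
      · exact Or.inr (hsupp _ _)
      · exact Or.inr (hsupp _ _)
    · intro v hv hv'
      rcases (hps v).1 hv with rfl | rfl | rfl <;> rcases (hqs _).1 hv' with h1 | h1 | h1
      · exact hxa h1.symm
      · exact hdis _ _ (hsupp i _) (hsupp j _) h1
      · exact hdis _ _ (hsupp i _) (hsupp j _) h1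
      · exact hxa' h1.symm
      · exact hdis _ _ (hsupp i _) (hsupp j _) h1
      · exact hdis _ _ (hsupp i _) (hsupp j _) h1
      · exact hdis _ _ hxs.1 hys.1 h1.symm
      · exact hyb h1
      · exact hyb' h1
  · intro i e hei
    obtain ⟨a, rfl⟩ := he i e hei
    exact ⟨a, _, _, _, rfl, hf0 i a, hf1 i a, by
      rw [show 2 * a + 2 = 2 * (a + 1) by ring, hf0]⟩

end MapGraph

/-! ### Regrouping the triangles at the special vertices -/

namespace MapGraph

variable {W S : Type*} {B : SimpleGraph (W ⊕ S)}

open Classical in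
/-- There is an induced cycle packing in which every cycle is either a triangle at a special vertex
`s`, marked by `some s`, or follows a closed curve of the bipartite graph; the closed curves
pairwise meet at most once, and at most two of the triangles at a special vertex are split by a set
of a given laminar family. -/
theorem exists_induced_packing {τ : Type*} {k : ℕ} (hbip : B ≤ completeBipartiteGraph W S)
    (h : Nonempty (CyclePacking (halfSquare B) k)) (F : τ → Set W)
    (hF : ∀ t t', F t ⊆ F t' ∨ F t' ⊆ F t ∨ Disjoint (F t) (F t')) :
    ∃ (C : CyclePacking (halfSquare B) k) (m : Fin k → Option S), C.IsInduced ∧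
      (∀ i s, m i = some s → (C.cycle i).length = 3 ∧
        ∀ u ∈ (C.cycle i).support, B.Adj (Sum.inl u) (Sum.inr s)) ∧
      (∀ s t, {i | m i = some s ∧ Splits (F t) {v | v ∈ (C.cycle i).support}}.ncard ≤ 2) ∧
      ∃ (f : {i // m i = none} → ℤ → W ⊕ S) (n : {i // m i = none} → ℕ),
        (∀ i, IsClosedCurve B (f i) (2 * n i)) ∧
        (∀ i j, i ≠ j → ∀ a b a' b', f i a = f j b → f i a' = f j b' → f i a = f i a') ∧
        (∀ i, ∀ e ∈ (C.cycle i.1).edges, ∃ a u v s, e = s(u, v) ∧ f i (2 * a) = Sum.inl u ∧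
          f i (2 * a + 1) = Sum.inr s ∧ f i (2 * a + 2) = Sum.inl v) := by
  obtain ⟨C, hC⟩ := exists_isMinimalPacking h
  obtain ⟨f, n, hf, hshare, hedge⟩ := hC.exists_closedCurves hbip
  let m : Fin k → Option S := fun i =>
    if h : IsMono B (C.cycle i) then some h.2.choose else none
  have hm : ∀ i s, m i = some s → (C.cycle i).length = 3 ∧
      ∀ u ∈ (C.cycle i).support, B.Adj (Sum.inl u) (Sum.inr s) := by
    intro i s his
    by_cases hi : IsMono B (C.cycle i)
    · have h1 : m i = some hi.2.choose := dif_pos hi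
      rw [h1, Option.some.injEq] at his
      exact ⟨hi.1, his ▸ hi.2.choose_spec⟩
    · have h1 : m i = none := dif_neg hi
      rw [h1] at his; cases his
  have hnone : ∀ i, m i = none → ¬ IsMono B (C.cycle i) := by
    intro i hi h
    have h1 : m i = some h.2.choose := dif_pos h
    rw [h1] at hi; cases hi
  -- Each triangle is assigned to one special vertex only, so the vertex sets `M s` are disjoint and
  -- can be regrouped independently.
  let J : S → Finset (Fin k) := fun s => {i | m i = some s}
  let M : S → Finset W := fun s => (J s).biUnion fun i => (C.cycle i).support.toFinset
  have hJ : ∀ s i, i ∈ J s ↔ m i = some s := fun s i => by simp [J]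
  have hM : ∀ s v, v ∈ M s ↔ ∃ i, m i = some s ∧ v ∈ (C.cycle i).support := fun s v => by
    simp [M, J]
  have hMcard : ∀ s, (M s).card = 3 * (J s).card := by
    intro s
    rw [Finset.card_biUnion]
    · rw [Finset.sum_congr rfl (g := fun _ => 3), Finset.sum_const, smul_eq_mul, mul_comm]
      intro i hi
      rw [(C.isCycle i).card_support_toFinset, (hm i s ((hJ s i).1 hi)).1]
    · intro i _ j _ hij
      refine Finset.disjoint_left.2 fun v hv hv' => ?_
      exact C.disjoint i j hij v (List.mem_toFinset.1 hv) (List.mem_toFinset.1 hv')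
  have hP := fun s => exists_triples F hF (J s) (M s) (hMcard s)
  choose P hP3 hPd hPs using hP
  have hadj : ∀ s, ∀ v ∈ M s, B.Adj (Sum.inl v) (Sum.inr s) := by
    intro s v hv
    obtain ⟨i, hi, hv⟩ := (hM s v).1 hv
    exact (hm i s hi).2 v hv
  have hex : ∀ i, ∃ c : Σ v, (halfSquare B).Walk v v, c.2.IsCycle ∧
      (m i = none → c = ⟨_, C.cycle i⟩) ∧
      ∀ s, m i = some s → c.2.length = 3 ∧ ∀ v, v ∈ c.2.support ↔ v ∈ P s i := by
    intro i
    rcases hi : m i with _ | s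
    · exact ⟨⟨_, C.cycle i⟩, C.isCycle i, fun _ => rfl, fun s hs => by cases hs⟩
    · obtain ⟨hsub, hcard⟩ := hP3 s i ((hJ s i).2 hi)
      obtain ⟨x, y, z, hxy, hxz, hyz, hP⟩ := Finset.card_eq_three.1 hcard
      obtain ⟨b, p, hp, hpm, hps⟩ := exists_isMono hbip hxy hyz hxz
        (hadj s x (hsub (by simp [hP]))) (hadj s y (hsub (by simp [hP])))
        (hadj s z (hsub (by simp [hP])))
      refine ⟨⟨b, p⟩, hp, fun h => (by cases h), fun s' hs' => ⟨hpm.1, fun v => ?_⟩⟩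
      rw [Option.some.injEq] at hs'
      subst hs'
      rw [hps, hP]; simp
  choose c hc hc0 hc1 using hex
  have hsupp : ∀ i v, v ∈ (c i).2.support →
      (m i = none ∧ v ∈ (C.cycle i).support) ∨ ∃ s, m i = some s ∧ v ∈ P s i ∧ v ∈ M s := by
    intro i v hv
    rcases hi : m i with _ | s
    · rw [hc0 i hi] at hv; exact Or.inl ⟨rfl, hv⟩
    · have h1 := ((hc1 i s hi).2 v).1 hv
      exact Or.inr ⟨s, rfl, h1, (hP3 s i ((hJ s i).2 hi)).1 h1⟩
  have hd : ∀ i j, i ≠ j → ∀ v, v ∈ (c i).2.support → v ∉ (c j).2.support := by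
    intro i j hij v hv hv'
    rcases hsupp i v hv with ⟨hi, hv⟩ | ⟨s, hi, hvP, hvM⟩ <;>
    rcases hsupp j v hv' with ⟨hj, hv'⟩ | ⟨s', hj, hvP', hvM'⟩
    · exact C.disjoint i j hij v hv hv'
    · obtain ⟨l, hl, hvl⟩ := (hM s' v).1 hvM'
      refine C.disjoint i l (fun h => ?_) v hv hvl
      rw [h, hl] at hi; cases hi
    · obtain ⟨l, hl, hvl⟩ := (hM s v).1 hvM
      refine C.disjoint j l (fun h => ?_) v hv' hvl
      rw [h, hl] at hj; cases hj
    · by_cases hss : s = s'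
      · subst hss
        exact Finset.disjoint_left.1 (hPd s i ((hJ s i).2 hi) j ((hJ s j).2 hj) hij) hvP hvP'
      · obtain ⟨l, hl, hvl⟩ := (hM s v).1 hvM
        obtain ⟨l', hl', hvl'⟩ := (hM s' v).1 hvM'
        refine C.disjoint l l' (fun h => hss ?_) v hvl hvl'
        rw [h, hl', Option.some.injEq] at hl
        exact hl.symm
  refine ⟨⟨fun i => (c i).1, fun i => (c i).2, hc, hd⟩, m, ?_, ?_, ?_,
    fun i => f ⟨i.1, hnone i.1 i.2⟩, fun i => n ⟨i.1, hnone i.1 i.2⟩, fun i => hf _, ?_, ?_⟩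
  · intro i u hu v hv huv
    rcases hi : m i with _ | s
    · have h1 := hC.isInduced i u
      simp only at hu hv ⊢
      rw [hc0 i hi] at hu hv ⊢
      exact h1 hu v hv huv
    · by_contra hch
      obtain ⟨b, p, hp, hlt, -⟩ := (hc i).exists_shorter_of_chord hu hv huv hch
      have h1 := hp.three_le_length
      have h2 := (hc1 i s hi).1
      omega
  · intro i s hi
    refine ⟨(hc1 i s hi).1, fun u hu => ?_⟩
    exact hadj s u ((hP3 s i ((hJ s i).2 hi)).1 (((hc1 i s hi).2 u).1 hu))
  · intro s t
    refine le_trans (le_of_eq ?_) ((hPs s t).trans (min_le_left _ _))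
    rw [← Set.ncard_coe_finset]
    congr 1
    ext i
    simp only [Set.mem_ofPred_eq, Finset.coe_filter, hJ]
    refine and_congr_right fun hi => ?_
    have : {v | v ∈ (c i).2.support} = (P s i : Set W) := by
      ext v; exact (hc1 i s hi).2 v
    rw [this]
  · exact fun i j hij => hshare _ _ fun h => hij (Subtype.ext (Subtype.mk.inj h))
  · intro i e he
    simp only at he
    rw [hc0 i.1 i.2] at he
    exact hedge ⟨i.1, hnone i.1 i.2⟩ e he

end MapGraph

/-! ### Crossing a node of the tree decomposition -/

namespace MapGraph

section TreeDecomposition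

variable {V : Type*} {G : SimpleGraph V} {T : RootedTree} {bag : T → Set V}

/-- The nodes whose bags contain `v` are connected, and a path in the tree can leave the descendants
of `t` only through `t`. -/
theorem IsTreeDecomposition.mem_bag_of_le (h : IsTreeDecomposition G T bag) {v : V} {a b t : T}
    (hva : v ∈ bag a) (hta : t ≤ a) (hvb : v ∈ bag b) (htb : ¬ t ≤ b) : v ∈ bag t := by
  by_contra hvt
  obtain ⟨p⟩ := (h.connected v).preconnected ⟨a, hva⟩ ⟨b, hvb⟩
  have key : ∀ (x y : {t | v ∈ bag t}), ((SimpleGraph.hasse T).induce {t | v ∈ bag t}).Walk x y →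
      t ≤ x.1 → t ≤ y.1 := by
    intro x y p
    induction p with
    | nil => exact id
    | @cons x y _ hxy _ ih =>
      intro htx
      apply ih
      rcases SimpleGraph.hasse_adj.1 (SimpleGraph.induce_adj.1 hxy) with hc | hc
      · exact htx.trans hc.le
      · have hne : t ≠ x.1 := fun e => hvt (e ▸ x.2)
        rcases le_total_of_directed hc.le htx with h1 | h1
        · exact h1
        · rcases hc.eq_or_eq h1 htx with h2 | h2
          · exact h2.le
          · exact absurd h2 hne
  exact htb (key _ _ p hta)

theorem bag_subset_cone (t : T) : bag t ⊆ cone bag t := fun _ hv => ⟨t, le_rfl, hv⟩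

/-- A neighbour of a vertex outside the cone of `t` is in the bag of `t` or outside the cone. -/
theorem IsTreeDecomposition.mem_bag_of_adj (h : IsTreeDecomposition G T bag) {y z : V} {t : T}
    (hyz : G.Adj y z) (hy : y ∉ cone bag t) (hz : z ∈ cone bag t) : z ∈ bag t := by
  obtain ⟨b, hyb, hzb⟩ := h.edge_mem y z hyz
  obtain ⟨a, hta, hza⟩ := hz
  exact h.mem_bag_of_le hza hta hzb fun htb => hy ⟨b, htb, hyb⟩

/-- Comparable nodes give nested sets. Incomparable nodes have no common descendant, so a vertex in
both cones lies in the bag of `t`. -/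
theorem IsTreeDecomposition.laminar (h : IsTreeDecomposition G T bag) (t t' : T) :
    cone bag t \ bag t ⊆ cone bag t' \ bag t' ∨ cone bag t' \ bag t' ⊆ cone bag t \ bag t ∨
      Disjoint (cone bag t \ bag t) (cone bag t' \ bag t') := by
  have key : ∀ t t' : T, t ≤ t' → cone bag t' \ bag t' ⊆ cone bag t \ bag t := by
    rintro t t' hle v ⟨⟨a, hta, hva⟩, hv⟩
    refine ⟨⟨a, hle.trans hta, hva⟩, fun hvt => ?_⟩
    by_cases hle' : t' ≤ t
    · exact hv (le_antisymm hle hle' ▸ hvt)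
    · exact hv (h.mem_bag_of_le hva hta hvt hle')
  by_cases h1 : t ≤ t'
  · exact Or.inr (Or.inl (key t t' h1))
  by_cases h2 : t' ≤ t
  · exact Or.inl (key t' t h2)
  refine Or.inr (Or.inr (Set.disjoint_left.2 ?_))
  rintro v ⟨⟨a, hta, hva⟩, hv⟩ ⟨⟨b, htb, hvb⟩, -⟩
  refine hv (h.mem_bag_of_le hva hta hvb fun htb' => ?_)
  rcases le_total_of_directed htb' htb with h3 | h3
  · exact h2 h3
  · exact h1 h3

end TreeDecomposition

variable {W S : Type*} {B : SimpleGraph (W ⊕ S)} {T : RootedTree} {bag : T → Set (W ⊕ S)}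

theorem inl_mem_cone_of_mem_derivedBag {t : T} {u : W} (hu : u ∈ derivedBag B bag t) :
    Sum.inl u ∈ cone bag t := by
  rcases hu with hu | hu
  · exact bag_subset_cone t hu
  · simp only [Set.mem_iUnion] at hu
    obtain ⟨s, -, hs⟩ := hu
    exact hs.2

theorem mem_cone_derivedBag {t : T} {u : W} (hu : Sum.inl u ∈ cone bag t) :
    u ∈ cone (derivedBag B bag) t := by
  obtain ⟨a, hta, hua⟩ := hu
  exact ⟨a, hta, Or.inl hua⟩

theorem ncard_edges_at_le [Finite W] {G : SimpleGraph W} {k : ℕ} (C : CyclePacking G k) (u : W) :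
    {e | (∃ i, e ∈ (C.cycle i).edges) ∧ u ∈ e}.ncard ≤ 2 := by
  by_cases h : ∃ i, u ∈ (C.cycle i).support
  · obtain ⟨i, hi⟩ := h
    rw [← (C.isCycle i).ncard_neighborSet_toSubgraph_eq_two hi]
    have hsub : {e | (∃ i, e ∈ (C.cycle i).edges) ∧ u ∈ e} ⊆
        (fun v => s(u, v)) '' (C.cycle i).toSubgraph.neighborSet u := by
      rintro e ⟨⟨j, hj⟩, hu⟩
      obtain ⟨v, rfl⟩ := Sym2.mem_iff_exists.1 hu
      have huj := SimpleGraph.Walk.fst_mem_support_of_mem_edges _ hj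
      have hij : i = j := by
        by_contra hne
        exact C.disjoint i j hne u hi huj
      subst hij
      exact ⟨v, (SimpleGraph.Walk.adj_toSubgraph_iff_mem_edges).2 hj, rfl⟩
    exact (Set.ncard_le_ncard hsub).trans Set.ncard_image_le
  · have : {e | (∃ i, e ∈ (C.cycle i).edges) ∧ u ∈ e} = ∅ := by
      refine Set.eq_empty_of_forall_notMem ?_
      rintro e ⟨⟨j, hj⟩, hu⟩
      obtain ⟨v, rfl⟩ := Sym2.mem_iff_exists.1 hu
      exact h ⟨j, SimpleGraph.Walk.fst_mem_support_of_mem_edges _ hj⟩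
    rw [this]; simp

theorem ncard_edges_le {V : Type*} {G : SimpleGraph V} {u v : V} (w : G.Walk u v) :
    {e | e ∈ w.edges}.ncard ≤ w.length := by
  classical
  have : {e | e ∈ w.edges} = (w.edges.toFinset : Set (Sym2 V)) := by ext; simp
  rw [this, Set.ncard_coe_finset, ← SimpleGraph.Walk.length_edges]
  exact List.toFinset_card_le _

theorem ncard_biUnion_le_mul {α β : Type*} (s : Finset α) (f : α → Set β) (c : ℕ)
    (h : ∀ a ∈ s, (f a).ncard ≤ c) : (⋃ a ∈ s, f a).ncard ≤ c * s.card := by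
  refine (Finset.set_ncard_biUnion_le s f).trans ?_
  refine (Finset.sum_le_card_nsmul s _ c h).trans (le_of_eq ?_)
  rw [smul_eq_mul, mul_comm]

theorem exists_change {p : ℕ → Prop} {n : ℕ} (h : ¬ (p 0 ↔ p n)) : ∃ j < n, ¬ (p j ↔ p (j + 1)) := by
  by_contra hcon
  push Not at hcon
  apply h
  clear h
  induction n with
  | zero => rfl
  | succ n ih => exact (ih fun j hj => hcon j (by omega)).trans (hcon n (by omega))

/-- Where a closed curve leaves the cone of `t` through `s`, it visits the bag of `t` again. -/
theorem IsTreeDecomposition.exists_second_visit (h : IsTreeDecomposition B T bag) {t : T}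
    {f : ℤ → W ⊕ S} {n : ℕ} (hf : IsClosedCurve B f (2 * n)) {a : ℤ}
    (hcross : ¬ (f (2 * a) ∈ cone bag t ↔ f (2 * a + 2) ∈ cone bag t)) :
    ∃ b, f b ∈ bag t ∧ f b ≠ f (2 * a + 1) := by
  have hn := hf.pos
  have hper : f (2 * a + 2 + ((2 * n - 2 : ℕ) : ℤ)) = f (2 * a) := by
    rw [hf.eq_iff]
    refine ⟨1, ?_⟩
    rw [Nat.cast_sub (by omega)]
    push_cast; ring
  -- The rest of the curve, of length `2 * n - 2`, leads back to `f (2 * a)` and avoids `f (2 * a +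
  -- 1)`; it too must cross the border of the cone, which happens at a vertex of the bag.
  obtain ⟨j, hj, hch⟩ := exists_change (p := fun j : ℕ => f (2 * a + 2 + j) ∈ cone bag t)
    (n := 2 * n - 2) (by rw [hper]; simpa [iff_comm] using hcross)
  have hne : ∀ c : ℕ, c ≤ 2 * n - 2 → f (2 * a + 2 + c) ≠ f (2 * a + 1) := by
    intro c hc he
    have h1 := (hf.eq_iff _ _).1 he
    have h2 := Int.le_of_dvd (by omega) h1
    push_cast at h2
    omega
  have hadj : B.Adj (f (2 * a + 2 + j)) (f (2 * a + 2 + (j + 1 : ℕ))) := by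
    have := hf.adj (2 * a + 2 + j)
    rwa [add_assoc _ (j : ℤ) 1] at this
  by_cases h1 : f (2 * a + 2 + j) ∈ cone bag t
  · have h2 : f (2 * a + 2 + (j + 1 : ℕ)) ∉ cone bag t := fun h2 => hch (iff_of_true h1 h2)
    exact ⟨_, h.mem_bag_of_adj hadj.symm h2 h1, hne _ (by omega)⟩
  · have h2 : f (2 * a + 2 + (j + 1 : ℕ)) ∈ cone bag t := by
      by_contra h2; exact hch (iff_of_false h1 h2)
    exact ⟨_, h.mem_bag_of_adj hadj h1 h2, hne _ (by omega)⟩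

/-- A cycle packing as in `exists_induced_packing` has few edges across every node. -/
theorem IsTreeDecomposition.ncard_edgesBetween_le [Finite W] [Finite S]
    (h : IsTreeDecomposition B T bag) (hplanar : IsPlanar B) {k : ℕ}
    (C : CyclePacking (halfSquare B) k) (m : Fin k → Option S) (t : T)
    (hm : ∀ i s, m i = some s → (C.cycle i).length = 3 ∧
      ∀ u ∈ (C.cycle i).support, B.Adj (Sum.inl u) (Sum.inr s))
    (hsplit : ∀ s, {i | m i = some s ∧ Splits (Sum.inl ⁻¹' (cone bag t \ bag t))
      {v | v ∈ (C.cycle i).support}}.ncard ≤ 2)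
    (f : {i // m i = none} → ℤ → W ⊕ S) (n : {i // m i = none} → ℕ)
    (hf : ∀ i, IsClosedCurve B (f i) (2 * n i))
    (hshare : ∀ i j, i ≠ j → ∀ a b a' b', f i a = f j b → f i a' = f j b' → f i a = f i a')
    (hedge : ∀ i, ∀ e ∈ (C.cycle i.1).edges, ∃ a u v s, e = s(u, v) ∧ f i (2 * a) = Sum.inl u ∧
      f i (2 * a + 1) = Sum.inr s ∧ f i (2 * a + 2) = Sum.inl v) :
    (C.edgesBetween (derivedBag B bag t) (cone (derivedBag B bag) t)ᶜ).ncard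
      ≤ 14 * (bag t).ncard := by
  classical
  set F : Set W := Sum.inl ⁻¹' (cone bag t \ bag t)
  let X : Finset (W ⊕ S) := (bag t).toFinite.toFinset
  have hX : ∀ x, x ∈ X ↔ x ∈ bag t := fun x => Set.Finite.mem_toFinset _
  have hXcard : (bag t).ncard = X.card := Set.ncard_eq_toFinset_card _ _
  -- If `s` were outside the cone, its neighbour `u` would be in the bag. So `s` is in the cone and
  -- has the neighbour `v` outside.
  have hspecial : ∀ u v s, B.Adj (Sum.inl u) (Sum.inr s) → B.Adj (Sum.inl v) (Sum.inr s) →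
      u ∈ F → Sum.inl v ∉ cone bag t → Sum.inr s ∈ bag t := by
    intro u v s hus hvs hu hv
    refine h.mem_bag_of_adj hvs hv ?_
    by_contra hs
    exact hu.2 (h.mem_bag_of_adj hus.symm hs hu.1)
  -- The crossing edges are sorted into those with an end in the bag, those of split triangles, and
  -- those of lifted cycles.
  let E₁ : Set (Sym2 W) := ⋃ x ∈ X, {e | ∃ u, x = Sum.inl u ∧ (∃ i, e ∈ (C.cycle i).edges) ∧ u ∈ e}
  let E₂ : Set (Sym2 W) := ⋃ x ∈ X, {e | ∃ s, x = Sum.inr s ∧ ∃ i, m i = some s ∧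
    Splits F {v | v ∈ (C.cycle i).support} ∧ e ∈ (C.cycle i).edges}
  let E₃ : Set (Sym2 W) := {e | ∃ i : {i // m i = none}, e ∈ (C.cycle i.1).edges ∧
    ∃ u v, e = s(u, v) ∧ u ∈ F ∧ Sum.inl v ∉ cone bag t}
  have hcover : C.edgesBetween (derivedBag B bag t) (cone (derivedBag B bag) t)ᶜ ⊆
      E₁ ∪ E₂ ∪ E₃ := by
    rintro e ⟨⟨i, hi⟩, u, hu, v, hv, rfl⟩
    have hu' : Sum.inl u ∈ cone bag t := inl_mem_cone_of_mem_derivedBag hu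
    have hv' : Sum.inl v ∉ cone bag t := fun hc => hv (mem_cone_derivedBag hc)
    by_cases hub : Sum.inl u ∈ bag t
    · refine Or.inl (Or.inl ?_)
      simp only [E₁, Set.mem_iUnion]
      exact ⟨Sum.inl u, (hX _).2 hub, u, rfl, ⟨i, hi⟩, Sym2.mem_mk_left u v⟩
    have huF : u ∈ F := ⟨hu', hub⟩
    rcases hmi : m i with _ | s
    · exact Or.inr ⟨⟨i, hmi⟩, hi, u, v, rfl, huF, hv'⟩
    · refine Or.inl (Or.inr ?_)
      have hui := SimpleGraph.Walk.fst_mem_support_of_mem_edges _ hi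
      have hvi := SimpleGraph.Walk.snd_mem_support_of_mem_edges _ hi
      have hs := hspecial u v s ((hm i s hmi).2 u hui) ((hm i s hmi).2 v hvi) huF hv'
      simp only [E₂, Set.mem_iUnion]
      exact ⟨Sum.inr s, (hX _).2 hs, s, rfl, i, hmi,
        ⟨⟨u, hui, huF⟩, v, hvi, fun hvF => hv' hvF.1⟩, hi⟩
  have h₁ : E₁.ncard ≤ 2 * X.card := by
    refine ncard_biUnion_le_mul X _ 2 ?_
    rintro (u | s) -
    · refine (Set.ncard_le_ncard ?_).trans (ncard_edges_at_le C u)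
      rintro e ⟨u', hu', he⟩
      rw [Sum.inl.injEq] at hu'
      subst hu'
      exact he
    · simp
  have h₂ : E₂.ncard ≤ 6 * X.card := by
    refine ncard_biUnion_le_mul X _ 6 ?_
    rintro (u | s) -
    · simp
    · let I : Finset (Fin k) :=
        {i | m i = some s ∧ Splits F {v | v ∈ (C.cycle i).support}}
      have hI : I.card ≤ 2 := by
        refine le_trans (le_of_eq ?_) (hsplit s)
        rw [← Set.ncard_coe_finset]
        congr 1
        ext i
        simp [I]
      have hle := ncard_biUnion_le_mul I (fun i => {e | e ∈ (C.cycle i).edges}) 3 (by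
        intro i hi
        simp only [I, Finset.mem_filter, Finset.mem_univ, true_and] at hi
        rw [← (hm i s hi.1).1]
        exact ncard_edges_le _)
      refine (Set.ncard_le_ncard ?_).trans (hle.trans (by omega))
      rintro e ⟨s', hs', i, hi, hsp, he⟩
      rw [Sum.inr.injEq] at hs'
      subst hs'
      simp only [Set.mem_iUnion]
      exact ⟨i, by simp [I, hi, hsp], he⟩
  have h₃ : E₃.ncard ≤ 6 * X.card := by
    refine le_trans ?_ (IsClosedCurve.ncard_visits_le hplanar f _ hf hshare X)
    have hex : ∀ e ∈ E₃, ∃ z : {i // m i = none} × (W ⊕ S),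
        (z.2 ∈ X ∧ (∃ a, f z.1 a = z.2) ∧ ∃ b, f z.1 b ∈ X ∧ f z.1 b ≠ z.2) ∧
        ∃ a u v, e = s(u, v) ∧ f z.1 (2 * a) = Sum.inl u ∧ f z.1 (2 * a + 1) = z.2 ∧
          f z.1 (2 * a + 2) = Sum.inl v := by
      rintro e ⟨i, hei, u, v, rfl, hu, hv⟩
      obtain ⟨a, u', v', s, huv, ha0, ha1, ha2⟩ := hedge i _ hei
      have hadj0 : B.Adj (Sum.inl u') (Sum.inr s) := by
        rw [← ha0, ← ha1]; exact (hf i).adj _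
      have hadj2 : B.Adj (Sum.inl v') (Sum.inr s) := by
        rw [← ha1, ← ha2]
        have := (hf i).adj (2 * a + 1)
        rw [add_assoc] at this
        exact this.symm
      have hs : Sum.inr s ∈ bag t ∧
          ¬ (f i (2 * a) ∈ cone bag t ↔ f i (2 * a + 2) ∈ cone bag t) := by
        rw [ha0, ha2]
        rcases Sym2.eq_iff.1 huv with ⟨rfl, rfl⟩ | ⟨rfl, rfl⟩
        · exact ⟨hspecial u v s hadj0 hadj2 hu hv, fun hiff => hv (hiff.1 hu.1)⟩
        · exact ⟨hspecial u v s hadj2 hadj0 hu hv, fun hiff => hv (hiff.2 hu.1)⟩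
      obtain ⟨b, hb, hbne⟩ := h.exists_second_visit (hf i) hs.2
      exact ⟨(i, Sum.inr s), ⟨⟨(hX _).2 hs.1, ⟨_, ha1⟩, b, (hX _).2 hb, ha1 ▸ hbne⟩,
        a, u', v', huv, ha0, ha1, ha2⟩⟩
    rcases E₃.eq_empty_or_nonempty with hemp | ⟨e₀, he₀⟩
    · simp [hemp]
    have : Nonempty ({i // m i = none} × (W ⊕ S)) := ⟨(hex e₀ he₀).choose⟩
    choose! z hz using hex
    -- A curve passes each special vertex at most once per period, so curve and special vertex
    -- determine the edge.
    refine Set.ncard_le_ncard_of_injOn z (fun e he => (hz e he).1) ?_ (Set.toFinite _)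
    intro e he e' he' hzz
    obtain ⟨-, a, u, v, rfl, ha0, ha1, ha2⟩ := hz e he
    obtain ⟨-, a', u', v', rfl, ha0', ha1', ha2'⟩ := hz e' he'
    rw [← hzz] at ha0' ha1' ha2'
    set i := (z s(u, v)).1
    have hdvd := ((hf i).eq_iff _ _).1 (ha1.trans ha1'.symm)
    have hu : f i (2 * a) = f i (2 * a') := ((hf i).eq_iff _ _).2 (by
      convert hdvd using 1; ring)
    have hv : f i (2 * a + 2) = f i (2 * a' + 2) := ((hf i).eq_iff _ _).2 (by
      convert hdvd using 1; ring)
    rw [ha0, ha0', Sum.inl.injEq] at hu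
    rw [ha2, ha2', Sum.inl.injEq] at hv
    rw [hu, hv]
  have h₄ := Set.ncard_le_ncard hcover
  have h₅ := Set.ncard_union_le (E₁ ∪ E₂) E₃
  have h₆ := Set.ncard_union_le E₁ E₂
  omega

end MapGraph

/-! ### The crossing lemma -/

theorem mainTheorem9 {W S : Type*} [Finite W] [Finite S]
    (B : SimpleGraph (W ⊕ S)) (hbip : B ≤ completeBipartiteGraph W S)
    (hplanar : MapGraph.IsPlanar B)
    (T : RootedTree) [Fintype T] (bag : T → Set (W ⊕ S))
    (hnice : MapGraph.IsNiceTreeDecomposition B T bag)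
    (k : ℕ) (hwidth : (MapGraph.width bag : ℝ) < 15 * √(k : ℝ))
    (hyes : Nonempty (MapGraph.CyclePacking (MapGraph.halfSquare B) k)) :
    ∃ C : MapGraph.CyclePacking (MapGraph.halfSquare B) k,
      C.IsInduced ∧
      ∀ t : T,
        ((C.edgesBetween (MapGraph.derivedBag B bag t)
            (MapGraph.cone (MapGraph.derivedBag B bag) t)ᶜ).ncard : ℝ) ≤ 360 * √(k : ℝ) := by
  have hdec := hnice.toIsTreeDecomposition
  obtain ⟨C, m, hind, hm, hsplit, f, n, hf, hshare, hedge⟩ :=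
    MapGraph.exists_induced_packing hbip hyes
      (fun t => Sum.inl ⁻¹' (MapGraph.cone bag t \ bag t)) (fun t t' => by
        rcases hdec.laminar t t' with h | h | h
        · exact Or.inl (Set.preimage_mono h)
        · exact Or.inr (Or.inl (Set.preimage_mono h))
        · exact Or.inr (Or.inr (h.preimage _)))
  refine ⟨C, hind, fun t => ?_⟩
  have hmain := hdec.ncard_edgesBetween_le hplanar C m t hm (fun s => hsplit s t) f n hf hshare
    hedge
  -- For `k = 0` the bound is 0 and there are no cycles. For `k ≥ 1`, the 1 in the width is absorbed
  -- by `1 ≤ √k`: 14(15√k + 1) ≤ 224√k.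
  rcases Nat.eq_zero_or_pos k with rfl | hk
  · have hempty : C.edgesBetween (MapGraph.derivedBag B bag t)
        (MapGraph.cone (MapGraph.derivedBag B bag) t)ᶜ = ∅ := by
      refine Set.eq_empty_of_forall_notMem ?_
      rintro e ⟨⟨i, -⟩, -⟩
      exact i.elim0
    simp [hempty]
  · have hsqrt : 1 ≤ √(k : ℝ) := Real.one_le_sqrt.2 (by exact_mod_cast hk)
    have hsup : (bag t).ncard ≤ Finset.univ.sup fun t => (bag t).ncard :=
      Finset.le_sup (f := fun t => (bag t).ncard) (Finset.mem_univ t)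
    have h1 : ((bag t).ncard : ℝ) - 1 < 15 * √(k : ℝ) := by
      refine lt_of_le_of_lt ?_ hwidth
      rw [MapGraph.width]
      push_cast
      have : ((bag t).ncard : ℝ) ≤ ((Finset.univ.sup fun t => (bag t).ncard : ℕ) : ℝ) := by
        exact_mod_cast hsup
      linarith
    have h2 : ((C.edgesBetween (MapGraph.derivedBag B bag t)
        (MapGraph.cone (MapGraph.derivedBag B bag) t)ᶜ).ncard : ℝ) ≤ 14 * ((bag t).ncard : ℝ) := by
      exact_mod_cast hmain
    linarith
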